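/- Let $X$ be a complex Banach space with dual $X^*$, let $\mathbb J=\mathbb R^+=[0,\infty)$ or $\mathbb J=\mathbb R$, and let $Y=BUC(\mathbb J,X^*)$ be the space of bounded uniformly continuous functions $f:\mathbb J\to X^*$ with the sup-norm. Map $Y$ into $L^1(\mathbb J,X)^*$ by $\langle g,f\rangle=\int_{\mathbb J}\langle g(r),f(r)\rangle\,dr$; write $w^*=\sigma(L^1(\mathbb J,X)^*,L^1(\mathbb J,X))$ and $\sigma=\sigma(Y,L^1(\mathbb J,X))$ for its restriction to $Y$. For $t\in\mathbb J$ put $(T(t)f)(s)=f_t(s)=f(t+s)$, and let $\operatorname{ac}$ denote the absolutely convex hull. **(1)** For every $f\in Y$, the $\sigma$-closure of $\operatorname{ac}\{f_t:t\in\mathbb J\}$ in $Y$ is $\sigma$-compact, and it equals the $w^*$-closure of $\operatorname{ac}\{f_t:t\in\mathbb J\}$ in $L^1(\mathbb J,X)^*$; in particular the latter is contained in $Y$. **(2)** $\{T(t)\}_{t\in\mathbb J}$ is a dual semigroup representation on $Y\subset L^1(\mathbb J,X)^*$. That is, the map $Y\to L^1(\mathbb J,X)^*$ is isometric and, for all $s,t\in\mathbb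 J$, $y\in Y$, $g\in L^1(\mathbb J,X)$: $T(s+t)=T(s)T(t)$; $s\mapsto\langle g,T(s)y\rangle$ is continuous; the $w^*$-closure of $\{T(t)y:t\in\mathbb J\}$ lies in $Y$; and the $w^*$-closed absolutely convex hull of $\{T(t)y:t\in\mathbb J\}$ lies in $Y$, is mapped into itself by $T(s)$, and $T(s)$ is $w^*$-continuous on it. Let $\mathcal T\subset L(Y)$ be the set of bounded operators $U$ on $Y$ for which there is a net $(s_\alpha)$ in $\mathbb J$ with $\langle g,T(s_\alpha)y\rangle\to\langle g,Uy\rangle$ for all $y\in Y$, $g\in L^1(\mathbb J,X)$. An idempotent $P\in\mathcal T$ is minimal if for every idempotent $Q\in\mathcal T$, $PQ=Q$ implies $QP=P$. For such a $P$ put $Y_a=PY$ and $Y_0=(I-P)Y$. **(3)** $\mathcal T$ contains a minimal idempotent, and for every minimal idempotent $P\in\mathcal T$, $$BUC(\mathbb J,X^*)=BUC(\mathbb J,X^*)_a\oplus BUC(\mathbb J,X^*)_0 .$$ Every $y\in Y_a$ is reversible: for each net $(s_\alpha)$ in $\mathbb J$ for which $w^*\text{-}\lim_\alpha T(s_\alpha)y$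 exists there is a net $(t_\gamma)$ in $\mathbb J$ with $w^*\text{-}\lim_\gamma w^*\text{-}\lim_\alpha T(t_\gamma)T(s_\alpha)y=y$. Every $y\in Y_0$ is a flight vector: $w^*\text{-}\lim_\alpha T(s_\alpha)y=0$ for some net $(s_\alpha)$ in $\mathbb J$. **(4)** Let $AP(\mathbb R,X^*)$ be the set of bounded continuous $f:\mathbb R\to X^*$ whose set of translates $\{f_t:t\in\mathbb R\}$ is relatively norm compact in $C_b(\mathbb R,X^*)$. For $S\in\{\mathbb R,\mathbb R^+\}$ let $W_0(S,X^*)$ be the set of bounded continuous $f:S\to X^*$ such that $\{f_t:t\in S\}$ is relatively weakly compact in $C_b(S,X^*)$ and $f_{t_n}\to0$ weakly in $C_b(S,X^*)$ for some sequence $(t_n)$ in $S$. Then, for every minimal idempotent $P\in\mathcal T$, $$AP(\mathbb R,X^*)|_{\mathbb J}\subset BUC(\mathbb J,X^*)_a,\qquad W_0(\mathbb J,X^*)\subset BUC(\mathbb J,X^*)_0,\qquad W_0(\mathbb R,X^*)|_{\mathbb J}\subset BUC(\mathbb J,X^*)_0 .$$ The splitting is nontrivial: if $X\neq\{0\}$,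 then $BUC(\mathbb J,X^*)_a\ne\{0\}$ and $BUC(\mathbb J,X^*)_0\neq\{0\}$. -/

import Mathlib

open Filter MeasureTheory
open scoped Topology BoundedContinuousFunction ComplexOrder

namespace DualRep

noncomputable section

/-! ### Dual semigroup representations

Throughout, a subspace `Y` of a dual space `E*` is given as a normed space `Y` together with
a bounded linear map `ι : Y → E*`; that `ι` is an isometric embedding is part of the
definition of a dual semigroup representation. -/

section General

variable {S E Y : Type*} [NormedAddCommGroup E] [NormedSpace ℂ E]
  [NormedAddCommGroup Y] [NormedSpace ℂ Y]

/-- The vector `y` of `Y`, seen in `E*` with its weak-star topology. -/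
def toW (ι : Y →L[ℂ] StrongDual ℂ E) (y : Y) : WeakDual ℂ E :=
  StrongDual.toWeakDual (ι y)

/-- The topology `σ(Y, E)` on `Y`, i.e. the weak-star topology of `E*` restricted to `Y`. -/
@[reducible] def sigma (ι : Y →L[ℂ] StrongDual ℂ E) : TopologicalSpace Y :=
  TopologicalSpace.induced (toW ι) inferInstance

/-- The orbit `{T(t) y : t ∈ S}`. -/
def orbit (T : S → Y →L[ℂ] Y) (y : Y) : Set Y := Set.range fun t => T t y

/-- The weak-star closed absolutely convex hull, taken in `E*`, of the orbit of `y`. -/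
def acHull (ι : Y →L[ℂ] StrongDual ℂ E) (T : S → Y →L[ℂ] Y) (y : Y) : Set (WeakDual ℂ E) :=
  closedAbsConvexHull ℂ (toW ι '' orbit T y)

/-- `{T(t)}_{t ∈ S} ⊆ L(Y)` is a dual semigroup representation on `Y ⊆ E*`. -/
structure IsDualRepresentation [AddCommMonoid S] [TopologicalSpace S]
    (ι : Y →L[ℂ] StrongDual ℂ E) (T : S → Y →L[ℂ] Y) : Prop where
  /-- `Y` is a normed subspace of `E*`. -/
  isometry : Isometry ι
  map_add : ∀ s t : S, T (s + t) = (T s).comp (T t)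
  continuous_orbit : ∀ (x : E) (y : Y), Continuous fun s => ι (T s y) x
  closure_orbit_subset : ∀ y : Y, closure (toW ι '' orbit T y) ⊆ Set.range (toW ι)
  acHull_subset : ∀ y : Y, acHull ι T y ⊆ Set.range (toW ι)
  mapsTo_acHull : ∀ (s : S) (y : Y),
    Set.MapsTo (T s) (toW ι ⁻¹' acHull ι T y) (toW ι ⁻¹' acHull ι T y)
  continuousOn_acHull : ∀ (s : S) (y : Y),
    @ContinuousOn Y Y (sigma ι) (sigma ι) (T s) (toW ι ⁻¹' acHull ι T y)

/-- The compactification `𝒯 ⊆ L(Y)`: all bounded operators on `Y` that are limits of nets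
`T(s_α)` in the weak-star operator topology (`⟨x, T(s_α) y⟩ → ⟨x, U y⟩` for all `x`, `y`). -/
def compactification (ι : Y →L[ℂ] StrongDual ℂ E) (T : S → Y →L[ℂ] Y) : Set (Y →L[ℂ] Y) :=
  {U | (fun y => toW ι (U y)) ∈ closure (Set.range fun (t : S) (y : Y) => toW ι (T t y))}

/-- `P` is an idempotent of the set `𝒯` of operators that is minimal with respect to the
relation `e ≤ f :⇔ f e = e` on the idempotents of `𝒯`: `Q ≤ P` implies `P ≤ Q`. -/
def IsMinimalIdempotent (𝒯 : Set (Y →L[ℂ] Y)) (P : Y →L[ℂ] Y) : Prop :=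
  P ∈ 𝒯 ∧ P * P = P ∧ ∀ Q ∈ 𝒯, Q * Q = Q → P * Q = Q → Q * P = P

/-- The first summand `P Y` of the splitting given by the idempotent `P`. -/
def aPart (P : Y →L[ℂ] Y) : Submodule ℂ Y := LinearMap.range (P : Y →ₗ[ℂ] Y)

/-- The second summand `(I - P) Y` of the splitting given by the idempotent `P`. -/
def zeroPart (P : Y →L[ℂ] Y) : Submodule ℂ Y :=
  LinearMap.range ((1 - P : Y →L[ℂ] Y) : Y →ₗ[ℂ] Y)

/-- `y` is reversible: for every net `s_α` in `S` for which `w*-lim_α T(s_α) y` exists there is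
a net `t_γ` in `S` with `w*-lim_γ w*-lim_α T(t_γ) T(s_α) y = y`. Nets in `S` are given by
proper filters on `S`. -/
def IsReversible (ι : Y →L[ℂ] StrongDual ℂ E) (T : S → Y →L[ℂ] Y) (y : Y) : Prop :=
  ∀ l : Filter S, l.NeBot → (∃ z, Tendsto (fun s => toW ι (T s y)) l (𝓝 z)) →
    ∃ g : S → Y, (∀ t, Tendsto (fun s => toW ι (T t (T s y))) l (𝓝 (toW ι (g t)))) ∧
      ∃ l' : Filter S, l'.NeBot ∧ Tendsto (fun t => toW ι (g t)) l' (𝓝 (toW ι y))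

/-- `y` is a flight vector: `w*-lim_α T(s_α) y = 0` for some net `s_α` in `S`. -/
def IsFlight (ι : Y →L[ℂ] StrongDual ℂ E) (T : S → Y →L[ℂ] Y) (y : Y) : Prop :=
  ∃ l : Filter S, l.NeBot ∧ Tendsto (fun s => toW ι (T s y)) l (𝓝 0)

end General

/-! ### Translations of bounded continuous functions -/

section Functions

variable {S F : Type*} [AddCommMonoid S] [TopologicalSpace S] [ContinuousAdd S]
  [NormedAddCommGroup F] [NormedSpace ℂ F]

/-- The translate `f_t = f(t + ·)`. -/
def translate (t : S) (f : S →ᵇ F) : S →ᵇ F :=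
  f.compContinuous ⟨fun s => t + s, continuous_const.add continuous_id⟩

variable (S F) in
/-- Eberlein weakly almost periodic functions: the orbit of `f` under translations is
relatively compact for the weak topology of `C_b(S, F)`. -/
def W : Set (S →ᵇ F) :=
  {f | IsCompact (closure (toWeakSpace ℂ (S →ᵇ F) '' Set.range fun t => translate t f))}

variable (S F) in
/-- The functions in `W(S, F)` for which some sequence of translates tends weakly to `0`. -/
def W₀ : Set (S →ᵇ F) :=
  {f | f ∈ W S F ∧ ∃ t : ℕ → S,
    Tendsto (fun n => toWeakSpace ℂ (S →ᵇ F) (translate (t n) f)) atTop (𝓝 0)}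

variable (F) in
/-- Almost periodic functions on `ℝ`: the orbit of `f` is relatively compact in norm. -/
def AP : Set (ℝ →ᵇ F) :=
  {f | IsCompact (closure (Set.range fun t => translate t f))}

/-- The restriction to `J` of a bounded continuous function on `ℝ`. -/
def restrictTo (J : AddSubmonoid ℝ) (f : ℝ →ᵇ F) : J →ᵇ F :=
  f.compContinuous ⟨fun s => (s : ℝ), continuous_subtype_val⟩

end Functions

/-! ### Bounded uniformly continuous functions on `J ⊆ ℝ` -/

section BUC

variable (J : AddSubmonoid ℝ) (F : Type*) [NormedAddCommGroup F] [NormedSpace ℂ F]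

/-- `BUC(J, F)` with the supremum norm. -/
def BUC : Submodule ℂ (J →ᵇ F) where
  carrier := {f | UniformContinuous f}
  add_mem' {f g} hf hg := by
    exact UniformContinuous.add (f := f) (g := g) hf hg
  zero_mem' := by
    exact (uniformContinuous_const : UniformContinuous fun _ : J => (0 : F))
  smul_mem' c f hf := by
    exact UniformContinuous.const_smul (f := f) hf c

variable {J F}

theorem translate_mem_BUC (t : J) {f : J →ᵇ F} (hf : f ∈ BUC J F) : translate t f ∈ BUC J F := by
  have h : UniformContinuous fun s : J => t + s :=
    Isometry.uniformContinuous (Isometry.of_dist_eq fun a b => by simp [Subtype.dist_eq])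
  exact UniformContinuous.comp (g := f) hf h

/-- The translation operator `T(t) f = f(t + ·)` on `BUC(J, F)`. -/
def translation (t : J) : BUC J F →L[ℂ] BUC J F :=
  LinearMap.mkContinuous
    { toFun := fun f => ⟨translate t f.1, translate_mem_BUC t f.2⟩
      map_add' := fun _ _ => rfl
      map_smul' := fun _ _ => rfl } 1 (fun f => by
        rw [one_mul]
        refine (BoundedContinuousFunction.norm_le (norm_nonneg _)).2 fun s => ?_
        exact f.1.norm_coe_le_norm (t + s))

end BUC

section Pairing

/-- Lebesgue measure on `J ⊆ ℝ`. -/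
abbrev vol (J : AddSubmonoid ℝ) : Measure J := Measure.comap (fun r : J => (r : ℝ)) volume

variable {J : AddSubmonoid ℝ} {X : Type*} [NormedAddCommGroup X] [NormedSpace ℂ X]

theorem norm_pairing_le (f : J →ᵇ StrongDual ℂ X) (x : X) (r : J) :
    ‖f r x‖ ≤ ‖f‖ * ‖x‖ :=
  ((f r).le_opNorm x).trans (mul_le_mul_of_nonneg_right (f.norm_coe_le_norm r) (norm_nonneg x))

theorem integrable_pairing (f : J →ᵇ StrongDual ℂ X) (g : Lp X 1 (vol J)) :
    Integrable (fun r => f r (g r)) (vol J) := by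
  have hg : Integrable (g : J → X) (vol J) := L1.integrable_coeFn g
  refine Integrable.mono' (hg.norm.const_mul ‖f‖) ?_
    (Eventually.of_forall fun r => norm_pairing_le f (g r) r)
  exact (ContinuousLinearMap.apply ℂ ℂ : X →L[ℂ] StrongDual ℂ X →L[ℂ] ℂ).aestronglyMeasurable_comp₂
    hg.aestronglyMeasurable f.continuous.aestronglyMeasurable

/-- The linear functional `g ↦ ∫_J ⟨g(r), f(r)⟩ dr` on `L¹(J, X)`. -/
def pairingLin (f : J →ᵇ StrongDual ℂ X) : Lp X 1 (vol J) →ₗ[ℂ] ℂ where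
  toFun g := ∫ r, f r (g r) ∂vol J
  map_add' g h := by
    rw [← integral_add (integrable_pairing f g) (integrable_pairing f h)]
    refine integral_congr_ae ?_
    filter_upwards [Lp.coeFn_add g h] with r hr
    rw [hr, Pi.add_apply, _root_.map_add]
  map_smul' c g := by
    rw [RingHom.id_apply, ← integral_smul]
    refine integral_congr_ae ?_
    filter_upwards [Lp.coeFn_smul c g] with r hr
    rw [hr, Pi.smul_apply, _root_.map_smul]

theorem pairingLin_bound (f : J →ᵇ StrongDual ℂ X) (g : Lp X 1 (vol J)) :
    ‖pairingLin f g‖ ≤ ‖f‖ * ‖g‖ := by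
  rw [L1.norm_eq_integral_norm, ← integral_const_mul]
  exact norm_integral_le_of_norm_le ((L1.integrable_coeFn g).norm.const_mul _)
    (Eventually.of_forall fun r => norm_pairing_le f (g r) r)

/-- The functional `g ↦ ∫_J ⟨g(r), f(r)⟩ dr`, as an element of `L¹(J, X)*`. -/
def pairing (f : J →ᵇ StrongDual ℂ X) : StrongDual ℂ (Lp X 1 (vol J)) :=
  LinearMap.mkContinuous (pairingLin f) ‖f‖ (pairingLin_bound f)

variable (J X) in
/-- The map `BUC(J, X*) → L¹(J, X)*`, `f ↦ (g ↦ ∫_J ⟨g(r), f(r)⟩ dr)`. -/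
def embed : BUC J (StrongDual ℂ X) →L[ℂ] StrongDual ℂ (Lp X 1 (vol J)) :=
  LinearMap.mkContinuous
    { toFun := fun f => pairing f.1
      map_add' := fun f₁ f₂ => by
        ext g
        exact integral_add (integrable_pairing f₁.1 g) (integrable_pairing f₂.1 g)
      map_smul' := fun c f => by
        ext g
        exact integral_smul c fun r => f.1 r (g r) } 1 (fun f => by
        rw [one_mul]
        exact LinearMap.mkContinuous_norm_le (pairingLin f.1) (norm_nonneg f.1) (pairingLin_bound f.1))

end Pairing

end

end DualRep

namespace DualRep

section Semigroups

/-- In a compact right topological semigroup every left ideal contains an idempotent which lies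
in a minimal left ideal. -/
theorem exists_idempotent_in_minimal_left_ideal {M : Type*} [AddSemigroup M]
    [TopologicalSpace M] [CompactSpace M] [T2Space M]
    (h : ∀ r : M, Continuous (· + r)) (q : M) :
    ∃ e, (∃ t, e = t + q) ∧ e + e = e ∧ ∀ s, ∃ t, t + (s + e) = e := by
  let 𝒮 : Set (Set M) := {N | IsClosed N ∧ N.Nonempty ∧ ∀ m, ∀ n ∈ N, m + n ∈ N}
  have hideal : ∀ r : M, Set.range (· + r) ∈ 𝒮 := fun r =>
    ⟨(isCompact_range (h r)).isClosed, ⟨_, r, rfl⟩, by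
      rintro m _ ⟨n, rfl⟩
      exact ⟨m + n, add_assoc m n r⟩⟩
  obtain ⟨N, hNq, hN⟩ := zorn_superset_nonempty 𝒮 (by
    intro c hc hchain hne
    refine ⟨⋂₀ c, ⟨isClosed_sInter fun t ht => (hc ht).1, ?_, fun m n hn t ht =>
      (hc ht).2.2 m n (hn t ht)⟩, fun s hs => Set.sInter_subset_of_mem hs⟩
    have : Nonempty c := hne.to_subtype
    rw [Set.sInter_eq_iInter]
    exact IsCompact.nonempty_iInter_of_directed_nonempty_isCompact_isClosed _
      (DirectedOn.directed_val (IsChain.directedOn hchain.symm)) (fun i => (hc i.2).2.1)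
      (fun i => (hc i.2).1.isCompact) (fun i => (hc i.2).1)) _ (hideal q)
  obtain ⟨hNc, hNne, hNl⟩ := hN.prop
  obtain ⟨e, he, hee⟩ := exists_idempotent_in_compact_add_subsemigroup h N hNne hNc.isCompact
    fun x _ y hy => hNl x y hy
  obtain ⟨t, ht⟩ := hNq he
  refine ⟨e, ⟨t, ht.symm⟩, hee, fun s => ?_⟩
  have hsub : Set.range (· + (s + e)) ⊆ N := by
    rintro _ ⟨m, rfl⟩
    exact hNl m _ (hNl s e he)
  have heq := hN.eq_of_subset (hideal (s + e)) hsub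
  rwa [← heq] at he

variable {Y : Type*} [NormedAddCommGroup Y] [NormedSpace ℂ Y] {𝒯 : Set (Y →L[ℂ] Y)}

/-- An idempotent in a minimal left ideal is a minimal idempotent. -/
theorem minimal_of_left_minimal {P : Y →L[ℂ] Y}
    (hmin : ∀ s ∈ 𝒯, ∃ t ∈ 𝒯, t * (s * P) = P) {Q : Y →L[ℂ] Y} (hQ : Q ∈ 𝒯) (hQQ : Q * Q = Q)
    (hPQ : P * Q = Q) : Q * P = P := by
  obtain ⟨t, -, ht⟩ := hmin Q hQ
  calc Q * P = P * (Q * P) := by rw [← mul_assoc, hPQ]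
    _ = t * (Q * P) * (Q * P) := by rw [ht]
    _ = t * (Q * (P * Q) * P) := by simp only [mul_assoc]
    _ = P := by rw [hPQ, hQQ, ht]

/-- A minimal idempotent lies in a minimal left ideal. -/
theorem left_minimal_of_minimal (hmul : ∀ a ∈ 𝒯, ∀ b ∈ 𝒯, a * b ∈ 𝒯)
    (hex : ∀ q ∈ 𝒯, ∃ e ∈ 𝒯, (∃ t ∈ 𝒯, e = t * q) ∧ e * e = e ∧
      ∀ s ∈ 𝒯, ∃ t ∈ 𝒯, t * (s * e) = e)
    {P : Y →L[ℂ] Y} (hP : P ∈ 𝒯) (hPP : P * P = P)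
    (hmin : ∀ Q ∈ 𝒯, Q * Q = Q → P * Q = Q → Q * P = P) {s : Y →L[ℂ] Y} (hs : s ∈ 𝒯) :
    ∃ t ∈ 𝒯, t * (s * P) = P := by
  obtain ⟨e, he, ⟨a, -, hea⟩, hee, hl⟩ := hex P hP
  have heP : e * P = e := by rw [hea, mul_assoc, hPP]
  have hPe : P * e = P := by
    have := hmin (P * e) (hmul P hP e he) (by
      rw [mul_assoc, ← mul_assoc e, heP, hee]) (by rw [← mul_assoc, hPP])
    rwa [mul_assoc, heP] at this
  obtain ⟨t, ht, hte⟩ := hl (s * P) (hmul s hs P hP)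
  refine ⟨P * t, hmul P hP t ht, ?_⟩
  calc P * t * (s * P) = P * (t * (s * P * e)) := by simp only [mul_assoc, hPe]
    _ = P := by rw [hte, hPe]

end Semigroups

section Envelope

variable {J : AddSubmonoid ℝ} {F : Type*} [NormedAddCommGroup F] [NormedSpace ℂ F]

theorem norm_apply_le (f : BUC J F) (s : J) : ‖f.1 s‖ ≤ ‖f‖ := f.1.norm_coe_le_norm s

theorem norm_le_of_forall {f : BUC J F} {C : ℝ} (hC : 0 ≤ C) (h : ∀ s, ‖f.1 s‖ ≤ C) : ‖f‖ ≤ C :=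
  (BoundedContinuousFunction.norm_le hC).2 h

theorem norm_translation_le (t : J) (f : BUC J F) : ‖translation t f‖ ≤ ‖f‖ :=
  norm_le_of_forall (norm_nonneg _) fun s => norm_apply_le f (t + s)

theorem translation_add (s t : J) :
    (translation (s + t) : BUC J F →L[ℂ] BUC J F) = (translation s).comp (translation t) := by
  ext f r
  change f.1 (s + t + r) = f.1 (t + (s + r))
  rw [add_comm s t, add_assoc]

theorem translation_translation (s t : J) (f : BUC J F) :
    translation s (translation t f) = translation (s + t) f := by
  rw [translation_add]; rfl

/-- The orbits of the translations on `BUC` are norm continuous. -/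
theorem continuous_translation (f : BUC J F) : Continuous fun t : J => translation t f := by
  refine Metric.continuous_iff.2 fun t ε hε => ?_
  obtain ⟨δ, hδ, h⟩ := Metric.uniformContinuous_iff.1 f.2 (ε / 2) (half_pos hε)
  refine ⟨δ, hδ, fun s hs => ?_⟩
  rw [dist_eq_norm]
  refine (norm_le_of_forall (half_pos hε).le fun r => ?_).trans_lt (half_lt_self hε)
  change ‖f.1 (s + r) - f.1 (t + r)‖ ≤ _
  rw [← dist_eq_norm]
  refine (h ?_).le
  rw [Subtype.dist_eq] at hs ⊢
  simpa using hs

theorem exists_norm_translation_sub_lt {D : Set J} (hD : Dense D) (f : BUC J F) (r : J) {ε : ℝ}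
    (hε : 0 < ε) : ∃ d ∈ D, ‖translation r f - translation d f‖ < ε := by
  obtain ⟨d, hd, h⟩ := hD.exists_mem_open
    (Metric.isOpen_ball.preimage (continuous_translation f)) ⟨r, Metric.mem_ball_self hε⟩
  refine ⟨d, hd, ?_⟩
  rw [← dist_eq_norm]
  exact Metric.mem_ball'.1 h

/-- The functions bounded by `‖y‖` whose modulus of continuity is controlled by the orbit
of `y`. -/
def envelope (y : BUC J F) : Set (BUC J F) :=
  {f | (∀ s, ‖f.1 s‖ ≤ ‖y‖) ∧ ∀ s t, ‖f.1 s - f.1 t‖ ≤ ‖translation s y - translation t y‖}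

theorem norm_le_of_mem_envelope {y f : BUC J F} (hf : f ∈ envelope y) : ‖f‖ ≤ ‖y‖ :=
  norm_le_of_forall (norm_nonneg _) hf.1

theorem mem_envelope_self (y : BUC J F) : y ∈ envelope y := by
  refine ⟨norm_apply_le y, fun s t => ?_⟩
  have := norm_apply_le (translation s y - translation t y) 0
  change ‖y.1 (s + 0) - y.1 (t + 0)‖ ≤ _ at this
  simpa only [add_zero] using this

theorem translation_mem_envelope (r : J) {y f : BUC J F} (hf : f ∈ envelope y) :
    translation r f ∈ envelope y := by
  refine ⟨fun s => hf.1 (r + s), fun s t => (hf.2 (r + s) (r + t)).trans ?_⟩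
  rw [← translation_translation, ← translation_translation, ← map_sub]
  exact norm_translation_le r _

theorem orbit_subset_envelope (y : BUC J F) : orbit translation y ⊆ envelope y := by
  rintro _ ⟨t, rfl⟩
  exact translation_mem_envelope t (mem_envelope_self y)

theorem absConvex_envelope (y : BUC J F) : AbsConvex ℂ (envelope y) := by
  constructor
  · rintro a ha _ ⟨f, hf, rfl⟩
    have ha' : ∀ v : F, ‖a • v‖ ≤ ‖v‖ := fun v => by
      rw [norm_smul]; exact mul_le_of_le_one_left (norm_nonneg v) ha
    refine ⟨fun s => (ha' (f.1 s)).trans (hf.1 s), fun s t => ?_⟩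
    change ‖a • f.1 s - a • f.1 t‖ ≤ _
    rw [← smul_sub]
    exact (ha' _).trans (hf.2 s t)
  · intro f hf g hg a b ha hb hab
    have hn : ‖a‖ + ‖b‖ = 1 := by
      rw [Complex.eq_coe_norm_of_nonneg ha, Complex.eq_coe_norm_of_nonneg hb] at hab
      exact_mod_cast hab
    have key : ∀ (C : ℝ) (v w : F), ‖v‖ ≤ C → ‖w‖ ≤ C → ‖a • v + b • w‖ ≤ C := by
      intro C v w hv hw
      calc ‖a • v + b • w‖ ≤ ‖a‖ * ‖v‖ + ‖b‖ * ‖w‖ := by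
            rw [← norm_smul, ← norm_smul]; exact norm_add_le _ _
        _ ≤ ‖a‖ * C + ‖b‖ * C := by gcongr
        _ = C := by rw [← add_mul, hn, one_mul]
    refine ⟨fun s => key _ _ _ (hf.1 s) (hg.1 s), fun s t => ?_⟩
    change ‖a • f.1 s + b • g.1 s - (a • f.1 t + b • g.1 t)‖ ≤ _
    rw [add_sub_add_comm, ← smul_sub, ← smul_sub]
    exact key _ _ _ (hf.2 s t) (hg.2 s t)

end Envelope

section Pointwise

variable {J : AddSubmonoid ℝ} {X : Type*} [NormedAddCommGroup X] [NormedSpace ℂ X]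

/-- The values of `f`, in the weak-star topology of `X*`. -/
noncomputable def pointwise (f : BUC J (StrongDual ℂ X)) (s : J) : WeakDual ℂ X :=
  StrongDual.toWeakDual (f.1 s)

theorem tendsto_weakDual_iff {α E : Type*} [NormedAddCommGroup E] [NormedSpace ℂ E] {l : Filter α}
    {φ : α → WeakDual ℂ E} {ψ : WeakDual ℂ E} :
    Tendsto φ l (𝓝 ψ) ↔ ∀ x : E, Tendsto (fun a => φ a x) l (𝓝 (ψ x)) :=
  tendsto_iff_forall_eval_tendsto_topDualPairing

theorem tendsto_pointwise_iff {α : Type*} {l : Filter α} {f : α → BUC J (StrongDual ℂ X)}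
    {f₀ : BUC J (StrongDual ℂ X)} :
    Tendsto (fun a => pointwise (f a)) l (𝓝 (pointwise f₀)) ↔
      ∀ s x, Tendsto (fun a => (f a).1 s x) l (𝓝 (f₀.1 s x)) := by
  rw [tendsto_pi_nhds]
  exact forall_congr' fun s => tendsto_weakDual_iff

theorem tendsto_toW_iff {α : Type*} {l : Filter α} {f : α → BUC J (StrongDual ℂ X)}
    {φ : WeakDual ℂ (Lp X 1 (vol J))} :
    Tendsto (fun a => toW (embed J X) (f a)) l (𝓝 φ) ↔
      ∀ g : Lp X 1 (vol J), Tendsto (fun a => ∫ r, (f a).1 r (g r) ∂vol J) l (𝓝 (φ g)) :=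
  tendsto_weakDual_iff

theorem exists_tendsto_pointwise {α : Type*} (u : Ultrafilter α) (y : BUC J (StrongDual ℂ X))
    {f : α → BUC J (StrongDual ℂ X)} (hf : ∀ a, f a ∈ envelope y) :
    ∃ f₀ ∈ envelope y, Tendsto (fun a => pointwise (f a)) u (𝓝 (pointwise f₀)) := by
  have hlim : ∀ s, ∃ φ : WeakDual ℂ X,
      Tendsto (fun a => pointwise (f a) s) u (𝓝 φ) := by
    intro s
    obtain ⟨φ, -, hφ⟩ := (WeakDual.isCompact_closedBall (𝕜 := ℂ) (E := X) 0 ‖y‖).ultrafilter_le_nhds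
      (u.map fun a => pointwise (f a) s) (by
        rw [Ultrafilter.coe_map, le_principal_iff, mem_map]
        refine Eventually.of_forall fun a => ?_
        exact mem_closedBall_zero_iff.2 ((hf a).1 s))
    exact ⟨φ, hφ⟩
  choose φ hφ using hlim
  have hev : ∀ s x, Tendsto (fun a => (f a).1 s x) u (𝓝 (φ s x)) := fun s x =>
    tendsto_weakDual_iff.1 (hφ s) x
  let φ' : J → StrongDual ℂ X := fun s => WeakDual.toStrongDual (φ s)
  have h1 : ∀ s, ‖φ' s‖ ≤ ‖y‖ := fun s =>
    ContinuousLinearMap.opNorm_le_bound _ (norm_nonneg _) fun x =>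
      le_of_tendsto (hev s x).norm (Eventually.of_forall fun a =>
        ((f a).1 s).le_of_opNorm_le ((hf a).1 s) x)
  have h2 : ∀ s t, ‖φ' s - φ' t‖ ≤ ‖translation s y - translation t y‖ := fun s t =>
    ContinuousLinearMap.opNorm_le_bound _ (norm_nonneg _) fun x =>
      le_of_tendsto ((hev s x).sub (hev t x)).norm (Eventually.of_forall fun a =>
        ((f a).1 s - (f a).1 t).le_of_opNorm_le ((hf a).2 s t) x)
  have huc : UniformContinuous φ' := by
    refine Metric.uniformContinuous_iff.2 fun ε hε => ?_
    obtain ⟨δ, hδ, h⟩ := Metric.uniformContinuous_iff.1 y.2 (ε / 2) (half_pos hε)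
    refine ⟨δ, hδ, fun s t hst => ?_⟩
    rw [dist_eq_norm]
    refine ((h2 s t).trans (norm_le_of_forall (half_pos hε).le fun r => ?_)).trans_lt
      (half_lt_self hε)
    change ‖y.1 (s + r) - y.1 (t + r)‖ ≤ _
    rw [← dist_eq_norm]
    refine (h ?_).le
    rw [Subtype.dist_eq] at hst ⊢
    simpa using hst
  refine ⟨⟨BoundedContinuousFunction.ofNormedAddCommGroup φ' huc.continuous ‖y‖ h1, huc⟩,
    ⟨h1, h2⟩, tendsto_pi_nhds.2 hφ⟩

/-- On an envelope, pointwise weak-star convergence implies weak-star convergence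
in `L¹(J, X)*`. -/
theorem tendsto_toW_of_tendsto_pointwise {α : Type*} {l : Filter α} {y : BUC J (StrongDual ℂ X)}
    {f : α → BUC J (StrongDual ℂ X)} {f₀ : BUC J (StrongDual ℂ X)} (hf : ∀ a, f a ∈ envelope y)
    (hf₀ : f₀ ∈ envelope y) (h : Tendsto (fun a => pointwise (f a)) l (𝓝 (pointwise f₀))) :
    Tendsto (fun a => toW (embed J X) (f a)) l (𝓝 (toW (embed J X) f₀)) := by
  refine tendsto_toW_iff.2 fun g => ?_
  have hg : Integrable (g : J → X) (vol J) := L1.integrable_coeFn g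
  obtain ⟨t, ⟨c, hc, htc⟩, hgt⟩ := hg.aestronglyMeasurable.isSeparable_ae_range
  obtain ⟨D, hD, hDd⟩ := TopologicalSpace.exists_countable_dense J
  have : Countable D := hD.to_subtype
  have : Countable c := hc.to_subtype
  let Φ : α → D × c → ℂ := fun a p => (f a).1 p.1 p.2
  let l' : Filter α := comap Φ (𝓝 fun p => f₀.1 p.1 p.2)
  have hev := tendsto_pointwise_iff.1 h
  have hl : l ≤ l' := tendsto_iff_comap.1 (tendsto_pi_nhds.2 fun p => hev p.1 p.2)
  have hl' : ∀ d ∈ D, ∀ x ∈ c, Tendsto (fun a => (f a).1 d x) l' (𝓝 (f₀.1 d x)) :=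
    fun d hd x hx => tendsto_pi_nhds.1 (tendsto_comap : Tendsto Φ l' _)
      (⟨⟨d, hd⟩, ⟨x, hx⟩⟩ : D × c)
  have hlim : ∀ r, ∀ x ∈ t, Tendsto (fun a => (f a).1 r x) l' (𝓝 (f₀.1 r x)) := by
    intro r x hx
    refine Metric.tendsto_nhds.2 fun ε hε => ?_
    obtain ⟨x', hx', hxx⟩ := Metric.mem_closure_iff.1 (htc hx) (ε / (5 * (‖y‖ + 1))) (by positivity)
    obtain ⟨d, hd, hdr⟩ := exists_norm_translation_sub_lt hDd y r
      (show 0 < ε / (5 * (‖x‖ + 1)) by positivity)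
    have hdr : ‖translation r y - translation d y‖ * ‖x‖ < ε / 5 := by
      calc ‖translation r y - translation d y‖ * ‖x‖
          ≤ ‖translation r y - translation d y‖ * (‖x‖ + 1) := by gcongr; linarith
        _ < ε / (5 * (‖x‖ + 1)) * (‖x‖ + 1) := by gcongr
        _ = ε / 5 := by field_simp
    have hy : ‖y‖ * ‖x - x'‖ < ε / 5 := by
      rw [← dist_eq_norm]
      calc ‖y‖ * dist x x' ≤ (‖y‖ + 1) * dist x x' := by gcongr; linarith
        _ < (‖y‖ + 1) * (ε / (5 * (‖y‖ + 1))) := by gcongr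
        _ = ε / 5 := by field_simp
    have key : ∀ k ∈ envelope y, ‖k.1 r x - k.1 d x'‖ < 2 * (ε / 5) := by
      intro k hk
      calc ‖k.1 r x - k.1 d x'‖ = ‖(k.1 r - k.1 d) x + k.1 d (x - x')‖ := by
            rw [_root_.sub_apply, map_sub]; congr 1; ring
        _ ≤ ‖translation r y - translation d y‖ * ‖x‖ + ‖y‖ * ‖x - x'‖ :=
            norm_add_le_of_le ((k.1 r - k.1 d).le_of_opNorm_le (hk.2 r d) x)
              ((k.1 d).le_of_opNorm_le (hk.1 d) _)
        _ < 2 * (ε / 5) := by linarith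
    filter_upwards [Metric.tendsto_nhds.1 (hl' d hd x' hx') (ε / 5) (by positivity)] with a ha
    have h1 := key _ (hf a)
    have h2 := key _ hf₀
    rw [← dist_eq_norm] at h1 h2
    have h3 := dist_triangle4 ((f a).1 r x) ((f a).1 d x') (f₀.1 d x') (f₀.1 r x)
    rw [dist_comm (f₀.1 d x')] at h3
    linarith
  have hdom : ∀ a, ∀ᵐ r ∂vol J, ‖(f a).1 r (g r)‖ ≤ ‖y‖ * ‖g r‖ := fun a =>
    Eventually.of_forall fun r => ((f a).1 r).le_of_opNorm_le ((hf a).1 r) _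
  refine (tendsto_integral_filter_of_dominated_convergence (fun r => ‖y‖ * ‖g r‖)
    (Eventually.of_forall fun a => (integrable_pairing (f a).1 g).aestronglyMeasurable)
    (Eventually.of_forall hdom) (hg.norm.const_mul _) ?_).mono_left hl
  filter_upwards [hgt] with r hr using hlim r _ hr

end Pointwise

section Embedding

variable {J : AddSubmonoid ℝ} {X : Type*} [NormedAddCommGroup X] [NormedSpace ℂ X]

theorem mem_of_nonneg (hJ : J = AddSubmonoid.nonneg ℝ ∨ J = ⊤) {r : ℝ} (hr : 0 ≤ r) : r ∈ J := by
  rcases hJ with rfl | rfl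
  · exact hr
  · trivial

theorem isClosed_coe (hJ : J = AddSubmonoid.nonneg ℝ ∨ J = ⊤) : IsClosed (J : Set ℝ) := by
  rcases hJ with rfl | rfl
  · exact isClosed_Ici
  · exact isClosed_univ

/-- Values of `f` are limits of averages. -/
theorem exists_average_close (hJ : J = AddSubmonoid.nonneg ℝ ∨ J = ⊤)
    (f : BUC J (StrongDual ℂ X)) (s : J) (x : X) {ε : ℝ} (hε : 0 < ε) :
    ∃ g : Lp X 1 (vol J), ‖g‖ ≤ ‖x‖ ∧ ‖f.1 s x - embed J X f g‖ ≤ ε * ‖x‖ := by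
  obtain ⟨δ, hδ, h⟩ := Metric.uniformContinuous_iff.1 f.2 ε hε
  set η := δ / 2 with hη
  have hη0 : 0 < η := half_pos hδ
  let A : Set J := (fun r : J => (r : ℝ)) ⁻¹' Set.Icc (s : ℝ) (s + η)
  have hA : MeasurableSet A := measurable_subtype_coe measurableSet_Icc
  have hsub : Set.Icc (s : ℝ) (s + η) ⊆ Set.range (Subtype.val : J → ℝ) := by
    intro r hr
    have : r - s + s ∈ J := J.add_mem (mem_of_nonneg hJ (sub_nonneg.2 hr.1)) s.2
    exact ⟨⟨r, by simpa using this⟩, rfl⟩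
  have hvol : vol J A = ENNReal.ofReal η := by
    have := (MeasurableEmbedding.subtype_coe (isClosed_coe hJ).measurableSet).comap_preimage
      volume (Set.Icc (s : ℝ) (s + η))
    refine this.trans ((congrArg volume (Set.inter_eq_self_of_subset_left hsub)).trans ?_)
    rw [Real.volume_Icc, add_sub_cancel_left]
  have hfin : vol J A ≠ ⊤ := by rw [hvol]; exact ENNReal.ofReal_ne_top
  have hreal : (vol J).real A = η := by
    rw [Measure.real, hvol, ENNReal.toReal_ofReal hη0.le]
  let c : X := ((η⁻¹ : ℝ) : ℂ) • x
  have hc : ‖c‖ = η⁻¹ * ‖x‖ := by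
    rw [norm_smul, Complex.norm_real, Real.norm_of_nonneg (inv_nonneg.2 hη0.le)]
  have hηc : ((η : ℝ) : ℂ) • c = x := by
    rw [smul_smul, ← Complex.ofReal_mul, mul_inv_cancel₀ hη0.ne', Complex.ofReal_one, one_smul]
  have hint : ∀ v : X, IntegrableOn (fun r => f.1 r v) A (vol J) := fun v => by
    refine Measure.integrableOn_of_bounded (M := ‖f‖ * ‖v‖) hfin ?_ ?_
    · exact (f.1.continuous.clm_apply continuous_const).aestronglyMeasurable
    · exact Eventually.of_forall fun r => norm_pairing_le f.1 v r
  refine ⟨indicatorConstLp 1 hA hfin c, ?_, ?_⟩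
  · rw [norm_indicatorConstLp one_ne_zero ENNReal.one_ne_top, hreal, hc]
    simp only [ENNReal.toReal_one, div_one, Real.rpow_one]
    rw [mul_right_comm, inv_mul_cancel₀ hη0.ne', one_mul]
  · have h1 : embed J X f (indicatorConstLp 1 hA hfin c) = ∫ r in A, f.1 r c ∂vol J := by
      rw [← integral_indicator hA]
      refine integral_congr_ae ?_
      filter_upwards [indicatorConstLp_coeFn (p := 1) (hs := hA) (hμs := hfin) (c := c)] with r hr
      rw [hr]
      by_cases hrA : r ∈ A
      · rw [Set.indicator_of_mem hrA, Set.indicator_of_mem hrA]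
      · rw [Set.indicator_of_notMem hrA, Set.indicator_of_notMem hrA, map_zero]
    have h2 : f.1 s x = ∫ _ in A, f.1 s c ∂vol J := by
      rw [setIntegral_const, hreal]
      conv_lhs => rw [← hηc, map_smul]
      rfl
    rw [h1, h2, ← integral_sub (integrableOn_const (C := f.1 s c) hfin enorm_ne_top) (hint c)]
    calc _ ≤ ε * ‖c‖ * (vol J).real A := by
          refine norm_setIntegral_le_of_norm_le_const hfin.lt_top fun r hr => ?_
          have hrs : dist s r < δ := by
            rw [Subtype.dist_eq, Real.dist_eq, abs_lt]
            have := hr.1; have := hr.2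
            constructor <;> linarith
          have hle : ‖f.1 s - f.1 r‖ ≤ ε := by
            rw [← dist_eq_norm]; exact (h hrs).le
          exact (f.1 s - f.1 r).le_of_opNorm_le hle c
      _ = ε * ‖x‖ := by rw [hreal, hc]; field_simp

theorem isometry_embed (hJ : J = AddSubmonoid.nonneg ℝ ∨ J = ⊤) : Isometry (embed J X) := by
  refine AddMonoidHomClass.isometry_of_norm (embed J X) fun f => le_antisymm ?_ ?_
  · exact LinearMap.mkContinuous_norm_le (pairingLin f.1) (norm_nonneg f.1) (pairingLin_bound f.1)
  · refine norm_le_of_forall (norm_nonneg _) fun s => ?_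
    refine ContinuousLinearMap.opNorm_le_bound _ (norm_nonneg _) fun x => ?_
    refine le_of_forall_pos_le_add fun ε hε => ?_
    obtain ⟨g, hg, h⟩ := exists_average_close hJ f s x (show 0 < ε / (‖x‖ + 1) by positivity)
    calc ‖f.1 s x‖ = ‖embed J X f g + (f.1 s x - embed J X f g)‖ := by rw [add_sub_cancel]
      _ ≤ ‖embed J X f‖ * ‖x‖ + ε / (‖x‖ + 1) * ‖x‖ :=
          norm_add_le_of_le ((embed J X f).le_of_opNorm_le_of_le le_rfl hg) h
      _ ≤ ‖embed J X f‖ * ‖x‖ + ε / (‖x‖ + 1) * (‖x‖ + 1) := by gcongr; linarith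
      _ = ‖embed J X f‖ * ‖x‖ + ε := by field_simp

theorem injective_toW (hJ : J = AddSubmonoid.nonneg ℝ ∨ J = ⊤) :
    Function.Injective (toW (embed J X)) :=
  (StrongDual.toWeakDual (𝕜 := ℂ)).injective.comp (isometry_embed hJ).injective

/-- On an envelope, weak-star convergence in `L¹(J, X)*` implies pointwise weak-star
convergence. -/
theorem tendsto_pointwise_of_tendsto_toW (hJ : J = AddSubmonoid.nonneg ℝ ∨ J = ⊤) {α : Type*}
    {l : Filter α} {y : BUC J (StrongDual ℂ X)} {f : α → BUC J (StrongDual ℂ X)}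
    {f₀ : BUC J (StrongDual ℂ X)} (hf : ∀ a, f a ∈ envelope y)
    (h : Tendsto (fun a => toW (embed J X) (f a)) l (𝓝 (toW (embed J X) f₀))) :
    Tendsto (fun a => pointwise (f a)) l (𝓝 (pointwise f₀)) := by
  refine (tendsto_iff_ultrafilter _ _ _).2 fun u hu => ?_
  obtain ⟨f₁, hf₁, h₁⟩ := exists_tendsto_pointwise u y hf
  have := tendsto_nhds_unique (tendsto_toW_of_tendsto_pointwise hf hf₁ h₁) (h.mono_left hu)
  rwa [injective_toW hJ this] at h₁

theorem exists_tendsto_toW {α : Type*} (u : Ultrafilter α) (y : BUC J (StrongDual ℂ X))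
    {f : α → BUC J (StrongDual ℂ X)} (hf : ∀ a, f a ∈ envelope y) :
    ∃ f₀ ∈ envelope y, Tendsto (fun a => toW (embed J X) (f a)) u (𝓝 (toW (embed J X) f₀)) :=
  let ⟨f₀, hf₀, h⟩ := exists_tendsto_pointwise u y hf
  ⟨f₀, hf₀, tendsto_toW_of_tendsto_pointwise hf hf₀ h⟩

theorem tendsto_translation_toW (hJ : J = AddSubmonoid.nonneg ℝ ∨ J = ⊤) {α : Type*}
    {l : Filter α} {y : BUC J (StrongDual ℂ X)} {f : α → BUC J (StrongDual ℂ X)}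
    {f₀ : BUC J (StrongDual ℂ X)} (hf : ∀ a, f a ∈ envelope y) (hf₀ : f₀ ∈ envelope y) (t : J)
    (h : Tendsto (fun a => toW (embed J X) (f a)) l (𝓝 (toW (embed J X) f₀))) :
    Tendsto (fun a => toW (embed J X) (translation t (f a))) l
      (𝓝 (toW (embed J X) (translation t f₀))) := by
  refine tendsto_toW_of_tendsto_pointwise (fun a => translation_mem_envelope t (hf a))
    (translation_mem_envelope t hf₀) (tendsto_pointwise_iff.2 fun s => ?_)
  exact tendsto_pointwise_iff.1 (tendsto_pointwise_of_tendsto_toW hJ hf h) (t + s)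

theorem isCompact_range_of_ultrafilter {α W : Type*} [TopologicalSpace W] {φ : α → W}
    (h : ∀ u : Ultrafilter α, ∃ a, Tendsto φ u (𝓝 (φ a))) : IsCompact (Set.range φ) := by
  refine isCompact_iff_ultrafilter_le_nhds.2 fun u hu => ?_
  have : (comap φ u).NeBot := comap_neBot_iff.2 fun t ht => by
    obtain ⟨_, hwt, a, rfl⟩ := u.neBot.nonempty_of_mem (inter_mem ht (le_principal_iff.1 hu))
    exact ⟨a, hwt⟩
  obtain ⟨a, ha⟩ := h (Ultrafilter.of (comap φ u))
  have hmap : (Ultrafilter.of (comap φ u)).map φ = u :=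
    Ultrafilter.coe_le_coe.1 (map_le_iff_le_comap.2 (Ultrafilter.of_le _))
  exact ⟨φ a, ⟨a, rfl⟩, hmap ▸ ha⟩

theorem isCompact_toW_image_envelope (y : BUC J (StrongDual ℂ X)) :
    IsCompact (toW (embed J X) '' envelope y) := by
  rw [Set.image_eq_range]
  refine isCompact_range_of_ultrafilter fun u => ?_
  obtain ⟨f₀, hf₀, h⟩ := exists_tendsto_toW u y fun f : envelope y => f.2
  exact ⟨⟨f₀, hf₀⟩, h⟩

end Embedding

theorem continuousOn_induced {V W : Type*} [t : TopologicalSpace W] {φ : V → W} {T : V → V}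
    {K : Set V} (h : ∀ f ∈ K, Tendsto (fun a : K => φ (T a))
      (comap (fun a : K => φ a) (𝓝 (φ f))) (𝓝 (φ (T f)))) :
    @ContinuousOn V V (t.induced φ) (t.induced φ) T K := by
  let := t.induced φ
  have hind : Topology.IsInducing φ := ⟨rfl⟩
  intro f hf
  rw [ContinuousWithinAt, nhdsWithin_eq_map_subtype_coe hf, tendsto_map'_iff,
    hind.tendsto_nhds_iff]
  exact (h f hf).mono_left (tendsto_iff_comap.1
    ((hind.continuous.comp continuous_subtype_val).tendsto (⟨f, hf⟩ : K)))

theorem isCompact_induced_iff {V W : Type*} [t : TopologicalSpace W] {φ : V → W} {K : Set V} :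
    @IsCompact V (t.induced φ) K ↔ IsCompact (φ '' K) := by
  let := t.induced φ
  exact Topology.IsInducing.isCompact_iff ⟨rfl⟩

section Hulls

variable {E Y : Type*} [NormedAddCommGroup E] [NormedSpace ℂ E]
  [NormedAddCommGroup Y] [NormedSpace ℂ Y]

theorem absConvex_image {V W : Type*} [AddCommGroup V] [Module ℂ V] [AddCommGroup W] [Module ℂ W]
    (L : V →ₗ[ℂ] W) {K : Set V} (hK : AbsConvex ℂ K) : AbsConvex ℂ (L '' K) := by
  refine ⟨?_, hK.2.linear_image L⟩
  rintro a ha _ ⟨_, ⟨v, hv, rfl⟩, rfl⟩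
  exact ⟨a • v, hK.1 a ha ⟨v, hv, rfl⟩, map_smul L a v⟩

theorem absConvex_preimage {V W : Type*} [AddCommGroup V] [Module ℂ V] [AddCommGroup W]
    [Module ℂ W] (L : V →ₗ[ℂ] W) {K : Set W} (hK : AbsConvex ℂ K) : AbsConvex ℂ (L ⁻¹' K) := by
  refine ⟨?_, hK.2.linear_preimage L⟩
  rintro a ha _ ⟨v, hv, rfl⟩
  exact hK.1 a ha ⟨L v, hv, (map_smul L a v).symm⟩

theorem image_absConvexHull {V W : Type*} [AddCommGroup V] [Module ℂ V] [AddCommGroup W]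
    [Module ℂ W] (L : V →ₗ[ℂ] W) (K : Set V) :
    L '' absConvexHull ℂ K = absConvexHull ℂ (L '' K) := by
  refine Set.Subset.antisymm ?_ ?_
  · rw [Set.image_subset_iff]
    refine absConvexHull_min ?_ (absConvex_preimage L absConvex_absConvexHull)
    exact Set.image_subset_iff.1 subset_absConvexHull
  · exact absConvexHull_min (Set.image_mono subset_absConvexHull)
      (absConvex_image L absConvex_absConvexHull)

theorem mapsTo_absConvexHull (A : Y →L[ℂ] Y) {K : Set Y} (hA : Set.MapsTo A K K) :
    Set.MapsTo A (absConvexHull ℂ K) (absConvexHull ℂ K) :=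
  absConvexHull_min (fun _ hv => subset_absConvexHull (hA hv))
    (absConvex_preimage (A : Y →ₗ[ℂ] Y) absConvex_absConvexHull)

/-- The map `toW ι` as a linear map. -/
noncomputable def toWLin (ι : Y →L[ℂ] StrongDual ℂ E) : Y →ₗ[ℂ] WeakDual ℂ E :=
  (StrongDual.toWeakDual (𝕜 := ℂ) (E := E)).toLinearMap ∘ₗ (ι : Y →ₗ[ℂ] StrongDual ℂ E)

theorem toW_image_closure_absConvexHull {S : Type*} (ι : Y →L[ℂ] StrongDual ℂ E)
    (T : S → Y →L[ℂ] Y) (y : Y) (h : acHull ι T y ⊆ Set.range (toW ι)) :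
    toW ι '' (@closure _ (sigma ι) (absConvexHull ℂ (orbit T y))) = acHull ι T y := by
  have hac : acHull ι T y = closure (toW ι '' absConvexHull ℂ (orbit T y)) :=
    closedAbsConvexHull_eq_closure_absConvexHull.trans
      (congrArg closure (image_absConvexHull (toWLin ι) (orbit T y)).symm)
  refine Set.Subset.antisymm ?_ fun w hw => ?_
  · rintro _ ⟨z, hz, rfl⟩
    rw [hac]
    exact closure_induced.1 hz
  · obtain ⟨z, rfl⟩ := h hw
    rw [hac] at hw
    exact ⟨z, closure_induced.2 hw, rfl⟩

end Hulls

section Representation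

variable {J : AddSubmonoid ℝ} {X : Type*} [NormedAddCommGroup X] [NormedSpace ℂ X]

theorem acHull_subset_image_envelope (y : BUC J (StrongDual ℂ X)) :
    acHull (embed J X) translation y ⊆ toW (embed J X) '' envelope y :=
  closedAbsConvexHull_min (Set.image_mono (orbit_subset_envelope y))
    (absConvex_image (toWLin (embed J X)) (absConvex_envelope y))
    (isCompact_toW_image_envelope y).isClosed

theorem isCompact_closure_absConvexHull (y : BUC J (StrongDual ℂ X)) :
    @IsCompact _ (sigma (embed J X))
      (@closure _ (sigma (embed J X)) (absConvexHull ℂ (orbit translation y))) := by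
  refine isCompact_induced_iff.2 ?_
  have hsub := acHull_subset_image_envelope y
  rw [toW_image_closure_absConvexHull _ _ _ (hsub.trans (Set.image_subset_range _ _))]
  exact (isCompact_toW_image_envelope y).of_isClosed_subset isClosed_closedAbsConvexHull hsub

theorem preimage_acHull_subset_envelope (hJ : J = AddSubmonoid.nonneg ℝ ∨ J = ⊤)
    (y : BUC J (StrongDual ℂ X)) :
    toW (embed J X) ⁻¹' acHull (embed J X) translation y ⊆ envelope y := by
  intro z hz
  obtain ⟨f, hf, hfz⟩ := acHull_subset_image_envelope y hz
  exact injective_toW hJ hfz ▸ hf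

theorem continuousOn_sigma_envelope (hJ : J = AddSubmonoid.nonneg ℝ ∨ J = ⊤) (t : J)
    (y : BUC J (StrongDual ℂ X)) :
    @ContinuousOn _ _ (sigma (embed J X)) (sigma (embed J X)) (translation t) (envelope y) := by
  refine continuousOn_induced fun f hf => ?_
  exact tendsto_translation_toW hJ (fun a : envelope y => a.2) hf t tendsto_comap

theorem mapsTo_acHull_translation (hJ : J = AddSubmonoid.nonneg ℝ ∨ J = ⊤) (t : J)
    (y : BUC J (StrongDual ℂ X)) :
    Set.MapsTo (translation t) (toW (embed J X) ⁻¹' acHull (embed J X) translation y)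
      (toW (embed J X) ⁻¹' acHull (embed J X) translation y) := by
  have himg := toW_image_closure_absConvexHull _ _ _
    ((acHull_subset_image_envelope y).trans (Set.image_subset_range _ _))
  have hK : toW (embed J X) ⁻¹' acHull (embed J X) translation y =
      @closure _ (sigma (embed J X)) (absConvexHull ℂ (orbit translation y)) := by
    rw [← himg, (injective_toW hJ).preimage_image]
  have hcont := @ContinuousOn.mono _ _ (sigma (embed J X)) (sigma (embed J X)) _ _ _
    (continuousOn_sigma_envelope hJ t y) (preimage_acHull_subset_envelope hJ y)
  have hH : Set.MapsTo (translation t) (absConvexHull ℂ (orbit translation y))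
      (absConvexHull ℂ (orbit translation y)) := by
    refine mapsTo_absConvexHull _ ?_
    rintro _ ⟨s, rfl⟩
    exact ⟨t + s, (translation_translation t s y).symm⟩
  rw [hK] at hcont ⊢
  exact @Set.MapsTo.closure_of_continuousOn _ _ (sigma (embed J X)) (sigma (embed J X)) _ _ _
    hH hcont

theorem isDualRepresentation (hJ : J = AddSubmonoid.nonneg ℝ ∨ J = ⊤) :
    IsDualRepresentation (embed J X) (translation : J → _) where
  isometry := isometry_embed hJ
  map_add := translation_add
  continuous_orbit g y := by
    have : Continuous fun s : J => embed J X (translation s y) :=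
      (embed J X).continuous.comp (continuous_translation y)
    exact this.clm_apply continuous_const
  closure_orbit_subset y := (closure_subset_closedAbsConvexHull).trans
    ((acHull_subset_image_envelope y).trans (Set.image_subset_range _ _))
  acHull_subset y := (acHull_subset_image_envelope y).trans (Set.image_subset_range _ _)
  mapsTo_acHull := mapsTo_acHull_translation hJ
  continuousOn_acHull t y := @ContinuousOn.mono _ _ (sigma (embed J X)) (sigma (embed J X)) _ _ _
    (continuousOn_sigma_envelope hJ t y) (preimage_acHull_subset_envelope hJ y)

end Representation

theorem exists_ultrafilter_of_mem_closure_range {α W : Type*} [TopologicalSpace W] {φ : α → W}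
    {w : W} (h : w ∈ closure (Set.range φ)) : ∃ u : Ultrafilter α, Tendsto φ u (𝓝 w) := by
  have : (comap φ (𝓝 w)).NeBot := comap_neBot_iff.2 fun t ht => by
    obtain ⟨_, hw, a, rfl⟩ := mem_closure_iff_nhds.1 h t ht
    exact ⟨a, hw⟩
  exact ⟨Ultrafilter.of _, tendsto_iff_comap.2 (Ultrafilter.of_le _)⟩

section Compactification

variable {J : AddSubmonoid ℝ} {X : Type*} [NormedAddCommGroup X] [NormedSpace ℂ X]

/-- `U` is the limit of the translation operators along the filter `l`. -/
def IsLimitOp (l : Filter J) (U : BUC J (StrongDual ℂ X) →L[ℂ] BUC J (StrongDual ℂ X)) : Prop :=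
  ∀ y, Tendsto (fun s => toW (embed J X) (translation s y)) l (𝓝 (toW (embed J X) (U y)))

theorem mem_compactification_iff {U : BUC J (StrongDual ℂ X) →L[ℂ] BUC J (StrongDual ℂ X)} :
    U ∈ compactification (embed J X) translation ↔ ∃ u : Ultrafilter J, IsLimitOp u U := by
  constructor
  · intro h
    obtain ⟨u, hu⟩ := exists_ultrafilter_of_mem_closure_range h
    exact ⟨u, fun y => tendsto_pi_nhds.1 hu y⟩
  · rintro ⟨u, hu⟩
    exact mem_closure_of_tendsto (tendsto_pi_nhds.2 hu)
      (Eventually.of_forall fun s => Set.mem_range_self s)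

theorem toW_add {E Y : Type*} [NormedAddCommGroup E] [NormedSpace ℂ E] [NormedAddCommGroup Y]
    [NormedSpace ℂ Y] (ι : Y →L[ℂ] StrongDual ℂ E) (y z : Y) :
    toW ι (y + z) = toW ι y + toW ι z := map_add (toWLin ι) y z

theorem toW_smul {E Y : Type*} [NormedAddCommGroup E] [NormedSpace ℂ E] [NormedAddCommGroup Y]
    [NormedSpace ℂ Y] (ι : Y →L[ℂ] StrongDual ℂ E) (c : ℂ) (y : Y) :
    toW ι (c • y) = c • toW ι y := map_smul (toWLin ι) c y

theorem toW_zero {E Y : Type*} [NormedAddCommGroup E] [NormedSpace ℂ E] [NormedAddCommGroup Y]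
    [NormedSpace ℂ Y] (ι : Y →L[ℂ] StrongDual ℂ E) : toW ι 0 = 0 := map_zero (toWLin ι)

theorem exists_isLimitOp (hJ : J = AddSubmonoid.nonneg ℝ ∨ J = ⊤) (u : Ultrafilter J) :
    ∃ U : BUC J (StrongDual ℂ X) →L[ℂ] BUC J (StrongDual ℂ X), IsLimitOp u U := by
  have h := fun y : BUC J (StrongDual ℂ X) => exists_tendsto_toW u y
    fun s => translation_mem_envelope s (mem_envelope_self y)
  choose U hU hlim using h
  refine ⟨LinearMap.mkContinuous
    { toFun := U
      map_add' := fun y z => injective_toW hJ ?_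
      map_smul' := fun c y => injective_toW hJ ?_ } 1 fun y => ?_, hlim⟩
  · refine tendsto_nhds_unique (hlim (y + z)) ?_
    rw [toW_add]
    refine ((hlim y).add (hlim z)).congr fun s => ?_
    rw [← toW_add, ← map_add]
  · refine tendsto_nhds_unique (hlim (c • y)) ?_
    rw [RingHom.id_apply, toW_smul]
    refine ((hlim y).const_smul c).congr fun s => ?_
    rw [← toW_smul, ← map_smul]
  · rw [one_mul]
    exact norm_le_of_mem_envelope (hU y)

namespace IsLimitOp

variable {l : Filter J} [l.NeBot] {U V : BUC J (StrongDual ℂ X) →L[ℂ] BUC J (StrongDual ℂ X)}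

theorem mem_envelope (hJ : J = AddSubmonoid.nonneg ℝ ∨ J = ⊤) (h : IsLimitOp l U)
    (y : BUC J (StrongDual ℂ X)) : U y ∈ envelope y := by
  obtain ⟨f, hf, hfU⟩ := (isCompact_toW_image_envelope y).isClosed.mem_of_tendsto (h y)
    (Eventually.of_forall fun s =>
      Set.mem_image_of_mem _ (translation_mem_envelope s (mem_envelope_self y)))
  exact injective_toW hJ hfU ▸ hf

theorem norm_apply_le (hJ : J = AddSubmonoid.nonneg ℝ ∨ J = ⊤) (h : IsLimitOp l U)
    (y : BUC J (StrongDual ℂ X)) : ‖U y‖ ≤ ‖y‖ :=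
  norm_le_of_mem_envelope (h.mem_envelope hJ y)

/-- Translations pass to the limit. -/
theorem tendsto_translation (hJ : J = AddSubmonoid.nonneg ℝ ∨ J = ⊤) (h : IsLimitOp l U) (t : J)
    (y : BUC J (StrongDual ℂ X)) :
    Tendsto (fun s => toW (embed J X) (translation t (translation s y))) l
      (𝓝 (toW (embed J X) (translation t (U y)))) :=
  tendsto_translation_toW hJ (fun s => translation_mem_envelope s (mem_envelope_self y))
    (h.mem_envelope hJ y) t (h y)

theorem apply_translation (hJ : J = AddSubmonoid.nonneg ℝ ∨ J = ⊤) (h : IsLimitOp l U) (t : J)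
    (y : BUC J (StrongDual ℂ X)) : U (translation t y) = translation t (U y) := by
  refine injective_toW hJ (tendsto_nhds_unique (h (translation t y)) ?_)
  refine (h.tendsto_translation hJ t y).congr fun s => ?_
  rw [translation_translation, translation_translation, add_comm]

theorem ext (hJ : J = AddSubmonoid.nonneg ℝ ∨ J = ⊤) (hU : IsLimitOp l U) (hV : IsLimitOp l V) :
    U = V :=
  ContinuousLinearMap.ext fun y => injective_toW hJ (tendsto_nhds_unique (hU y) (hV y))

end IsLimitOp

attribute [local instance] Ultrafilter.add Ultrafilter.addSemigroup

/-- Addition of ultrafilters corresponds to composition of the limit operators. -/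
theorem IsLimitOp.mul (hJ : J = AddSubmonoid.nonneg ℝ ∨ J = ⊤) {u v : Ultrafilter J}
    {U V : BUC J (StrongDual ℂ X) →L[ℂ] BUC J (StrongDual ℂ X)} (hU : IsLimitOp u U)
    (hV : IsLimitOp v V) : IsLimitOp (u + v : Ultrafilter J) (U * V) := by
  obtain ⟨W, hW⟩ := exists_isLimitOp (X := X) hJ (u + v)
  suffices W = U * V from this ▸ hW
  refine ContinuousLinearMap.ext fun y => injective_toW hJ ?_
  by_contra hne
  obtain ⟨N₁, N₂, hN₁, hN₂, hx₁, hx₂, hd⟩ := t2_separation hne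
  have h1 : ∀ᶠ s in (u : Filter J), ∀ᶠ t in (v : Filter J),
      toW (embed J X) (translation (s + t) y) ∈ N₁ :=
    (Ultrafilter.eventually_add u v _).1 (hW y (hN₁.mem_nhds hx₁))
  obtain ⟨s, hs1, hs2⟩ := (h1.and (hU (V y) (hN₂.mem_nhds hx₂))).exists
  obtain ⟨t, ht1, ht2⟩ :=
    (hs1.and (hV.tendsto_translation hJ s y (hN₂.mem_nhds hs2))).exists
  refine hd.le_bot ⟨ht1, ?_⟩
  rw [← translation_translation]
  exact ht2

theorem mul_mem_compactification (hJ : J = AddSubmonoid.nonneg ℝ ∨ J = ⊤)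
    {U V : BUC J (StrongDual ℂ X) →L[ℂ] BUC J (StrongDual ℂ X)}
    (hU : U ∈ compactification (embed J X) translation)
    (hV : V ∈ compactification (embed J X) translation) :
    U * V ∈ compactification (embed J X) translation := by
  obtain ⟨u, hu⟩ := mem_compactification_iff.1 hU
  obtain ⟨v, hv⟩ := mem_compactification_iff.1 hV
  exact mem_compactification_iff.2 ⟨u + v, hu.mul hJ hv⟩

set_option maxHeartbeats 1000000 in
theorem exists_left_minimal_idempotent (hJ : J = AddSubmonoid.nonneg ℝ ∨ J = ⊤)
    {q : BUC J (StrongDual ℂ X) →L[ℂ] BUC J (StrongDual ℂ X)}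
    (hq : q ∈ compactification (embed J X) translation) :
    ∃ e ∈ compactification (embed J X) translation,
      (∃ t ∈ compactification (embed J X) translation, e = t * q) ∧ e * e = e ∧
      ∀ s ∈ compactification (embed J X) translation,
        ∃ t ∈ compactification (embed J X) translation, t * (s * e) = e := by
  obtain ⟨q', hq'⟩ := mem_compactification_iff.1 hq
  obtain ⟨e', ⟨t', ht'⟩, hee', hmin⟩ :=
    exists_idempotent_in_minimal_left_ideal Ultrafilter.continuous_add_left q'
  obtain ⟨t, ht⟩ := exists_isLimitOp (X := X) hJ t'
  have he : IsLimitOp e' (t * q) := ht' ▸ ht.mul hJ hq'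
  obtain ⟨e, het⟩ : ∃ e, e = t * q := ⟨_, rfl⟩
  rw [← het] at he
  have hidem : e * e = e := by
    have := he.mul hJ he
    rw [hee'] at this
    exact this.ext hJ he
  refine ⟨e, mem_compactification_iff.2 ⟨_, he⟩, ⟨t, mem_compactification_iff.2 ⟨_, ht⟩, het⟩,
    hidem, fun s hs => ?_⟩
  obtain ⟨s', hs'⟩ := mem_compactification_iff.1 hs
  obtain ⟨r', hr'⟩ := hmin s'
  obtain ⟨r, hr⟩ := exists_isLimitOp (X := X) hJ r'
  refine ⟨r, mem_compactification_iff.2 ⟨_, hr⟩, ?_⟩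
  have := hr.mul hJ (hs'.mul hJ he)
  rw [hr'] at this
  exact this.ext hJ he

theorem exists_isMinimalIdempotent (hJ : J = AddSubmonoid.nonneg ℝ ∨ J = ⊤) :
    ∃ P, IsMinimalIdempotent (compactification (embed J X) translation) P := by
  obtain ⟨q, hq⟩ := exists_isLimitOp (X := X) hJ (pure 0)
  obtain ⟨P, hP, -, hPP, hmin⟩ :=
    exists_left_minimal_idempotent hJ (mem_compactification_iff.2 ⟨_, hq⟩)
  exact ⟨P, hP, hPP, fun Q hQ hQQ hPQ => minimal_of_left_minimal hmin hQ hQQ hPQ⟩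

/-- Every minimal idempotent lies in a minimal left ideal. -/
theorem IsMinimalIdempotent.left_minimal (hJ : J = AddSubmonoid.nonneg ℝ ∨ J = ⊤)
    {P : BUC J (StrongDual ℂ X) →L[ℂ] BUC J (StrongDual ℂ X)}
    (hP : IsMinimalIdempotent (compactification (embed J X) translation) P)
    {s : BUC J (StrongDual ℂ X) →L[ℂ] BUC J (StrongDual ℂ X)}
    (hs : s ∈ compactification (embed J X) translation) :
    ∃ t ∈ compactification (embed J X) translation, t * (s * P) = P :=
  left_minimal_of_minimal (fun _ ha _ hb => mul_mem_compactification hJ ha hb)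
    (fun _ hq => exists_left_minimal_idempotent hJ hq) hP.1 hP.2.1 hP.2.2 hs

end Compactification

section Splitting

variable {J : AddSubmonoid ℝ} {X : Type*} [NormedAddCommGroup X] [NormedSpace ℂ X]
  {P : BUC J (StrongDual ℂ X) →L[ℂ] BUC J (StrongDual ℂ X)}

theorem mem_aPart_iff {Y : Type*} [NormedAddCommGroup Y] [NormedSpace ℂ Y] {P : Y →L[ℂ] Y}
    (hPP : P * P = P) {y : Y} : y ∈ aPart P ↔ P y = y := by
  refine ⟨?_, fun h => ⟨y, h⟩⟩
  rintro ⟨z, rfl⟩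
  exact congrArg (fun Q : Y →L[ℂ] Y => Q z) hPP

theorem mem_zeroPart_iff {Y : Type*} [NormedAddCommGroup Y] [NormedSpace ℂ Y] {P : Y →L[ℂ] Y}
    (hPP : P * P = P) {y : Y} : y ∈ zeroPart P ↔ P y = 0 := by
  refine ⟨?_, fun h => ⟨y, ?_⟩⟩
  · rintro ⟨z, rfl⟩
    change P (z - P z) = 0
    rw [map_sub, show P (P z) = P z from congrArg (fun Q : Y →L[ℂ] Y => Q z) hPP, sub_self]
  · change y - P y = y
    rw [h, sub_zero]

theorem isCompl_parts {Y : Type*} [NormedAddCommGroup Y] [NormedSpace ℂ Y] {P : Y →L[ℂ] Y}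
    (hPP : P * P = P) : IsCompl (aPart P) (zeroPart P) := by
  have h := LinearMap.IsIdempotentElem.isCompl (f := (P : Y →ₗ[ℂ] Y))
    (LinearMap.ext fun y => congrArg (fun Q : Y →L[ℂ] Y => Q y) hPP)
  have hker : zeroPart P = LinearMap.ker (P : Y →ₗ[ℂ] Y) :=
    Submodule.ext fun y => mem_zeroPart_iff hPP
  rwa [hker]

theorem isFlight_of_mem_zeroPart
    (hP : IsMinimalIdempotent (compactification (embed J X) translation) P)
    {y : BUC J (StrongDual ℂ X)} (hy : y ∈ zeroPart P) : IsFlight (embed J X) translation y := by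
  obtain ⟨u, hu⟩ := mem_compactification_iff.1 hP.1
  refine ⟨u, inferInstance, ?_⟩
  have := hu y
  rwa [(mem_zeroPart_iff hP.2.1).1 hy, toW_zero] at this

theorem isReversible_of_mem_aPart (hJ : J = AddSubmonoid.nonneg ℝ ∨ J = ⊤)
    (hP : IsMinimalIdempotent (compactification (embed J X) translation) P)
    {y : BUC J (StrongDual ℂ X)} (hy : y ∈ aPart P) :
    IsReversible (embed J X) translation y := by
  intro l hl ⟨z, hz⟩
  obtain ⟨U, hU⟩ := exists_isLimitOp (X := X) hJ (Ultrafilter.of l)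
  obtain rfl : z = toW (embed J X) (U y) :=
    tendsto_nhds_unique (hz.mono_left (Ultrafilter.of_le l)) (hU y)
  have henv := fun s : J => translation_mem_envelope s (mem_envelope_self y)
  refine ⟨fun t => translation t (U y), fun t =>
    tendsto_translation_toW hJ henv (hU.mem_envelope hJ y) t hz, ?_⟩
  obtain ⟨V, hV, hVUP⟩ := hP.left_minimal hJ (mem_compactification_iff.2 ⟨_, hU⟩)
  obtain ⟨v, hv⟩ := mem_compactification_iff.1 hV
  refine ⟨v, inferInstance, ?_⟩
  have hPy := (mem_aPart_iff hP.2.1).1 hy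
  have hVU : V (U y) = y := by
    calc V (U y) = (V * (U * P)) y := by
          change _ = V (U (P y)); rw [hPy]
      _ = y := by rw [hVUP, hPy]
  have := hv (U y)
  rwa [hVU] at this

/-- A reversible vector with `0` in the weak-star closure of its orbit vanishes. -/
theorem eq_zero_of_isReversible (hJ : J = AddSubmonoid.nonneg ℝ ∨ J = ⊤)
    {y : BUC J (StrongDual ℂ X)} (hy : IsReversible (embed J X) translation y)
    (h0 : 0 ∈ closure (toW (embed J X) '' orbit translation y)) : y = 0 := by
  rw [orbit, ← Set.range_comp] at h0
  obtain ⟨u, hu⟩ := exists_ultrafilter_of_mem_closure_range h0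
  obtain ⟨g, hg, l', hl', hgl⟩ := hy u inferInstance ⟨0, hu⟩
  obtain ⟨U, hU⟩ := exists_isLimitOp (X := X) hJ u
  have hUy : U y = 0 := by
    refine injective_toW hJ (tendsto_nhds_unique (hU y) ?_)
    rwa [toW_zero]
  have hg0 : ∀ t, toW (embed J X) (g t) = 0 := fun t => by
    refine tendsto_nhds_unique (hg t) ?_
    have := hU.tendsto_translation hJ t y
    rwa [hUy, map_zero, toW_zero] at this
  refine injective_toW hJ ?_
  rw [toW_zero]
  exact (tendsto_nhds_unique (tendsto_const_nhds.congr fun t => (hg0 t).symm) hgl).symm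

end Splitting

section AlmostPeriodic

variable {F : Type*} [NormedAddCommGroup F] {f : ℝ →ᵇ F}

theorem AP.uniformContinuous (hf : f ∈ AP F) : UniformContinuous f := by
  refine Metric.uniformContinuous_iff.2 fun ε hε => ?_
  have htb : TotallyBounded (Set.range fun t => translate t f) :=
    (IsCompact.totallyBounded hf).subset subset_closure
  obtain ⟨c, hcr, hc, hcov⟩ :=
    Metric.finite_approx_of_totallyBounded htb (ε / 3) (by positivity)
  have hnear : ∀ᶠ h in 𝓝 (0 : ℝ), ∀ k ∈ c, dist (k h) (k 0) < ε / 3 :=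
    hc.eventually_all.2 fun k _ =>
      Metric.tendsto_nhds.1 (k.continuous.tendsto 0) _ (by positivity)
  obtain ⟨δ, hδ, h⟩ := Metric.eventually_nhds_iff.1 hnear
  refine ⟨δ, hδ, fun {a b} hab => ?_⟩
  obtain ⟨k, hk, hak⟩ := Set.mem_iUnion₂.1 (hcov ⟨b, rfl⟩)
  have h1 := (BoundedContinuousFunction.dist_coe_le_dist (f := translate b f) (g := k)
    (a - b)).trans_lt hak
  have h2 := (BoundedContinuousFunction.dist_coe_le_dist (f := translate b f) (g := k)
    0).trans_lt hak
  have h3 := h (y := a - b) (by simpa [Real.dist_eq] using hab) k hk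
  change dist (f (b + (a - b))) _ < _ at h1
  change dist (f (b + 0)) _ < _ at h2
  rw [add_sub_cancel] at h1
  rw [add_zero] at h2
  have h4 := dist_triangle4 (f a) (k (a - b)) (k 0) (f b)
  rw [dist_comm (k 0)] at h4
  linarith

theorem dist_translate_add (r s t : ℝ) :
    dist (translate (r + s) f) (translate (r + t) f) = dist (translate s f) (translate t f) := by
  refine le_antisymm ?_ ?_ <;> refine (BoundedContinuousFunction.dist_le dist_nonneg).2 fun q => ?_
  · have := BoundedContinuousFunction.dist_coe_le_dist (f := translate s f) (g := translate t f)
      (r + q)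
    change dist (f (s + (r + q))) (f (t + (r + q))) ≤ _ at this
    change dist (f (r + s + q)) (f (r + t + q)) ≤ _
    rwa [add_comm r s, add_comm r t, add_assoc, add_assoc]
  · have := BoundedContinuousFunction.dist_coe_le_dist (f := translate (r + s) f)
      (g := translate (r + t) f) (q - r)
    change dist (f (r + s + (q - r))) (f (r + t + (q - r))) ≤ _ at this
    change dist (f (s + q)) (f (t + q)) ≤ _
    rwa [show r + s + (q - r) = s + q by ring, show r + t + (q - r) = t + q by ring] at this

/-- Almost periodic functions have arbitrarily large almost periods. -/
theorem AP.exists_almost_period (hf : f ∈ AP F) (N : ℝ) {ε : ℝ} (hε : 0 < ε) :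
    ∃ t, N ≤ t ∧ dist (translate t f) f < ε := by
  obtain ⟨h, -, ψ, hψ, hlim⟩ := IsCompact.tendsto_subseq (s := closure _) hf
    (x := fun n : ℕ => translate (n * (|N| + 1)) f) fun n => subset_closure ⟨_, rfl⟩
  obtain ⟨M, hM⟩ := Metric.cauchySeq_iff.1 hlim.cauchySeq ε hε
  have hd := hM (M + 1) (Nat.le_succ M) M le_rfl
  set a : ℝ := ψ M * (|N| + 1)
  set b : ℝ := ψ (M + 1) * (|N| + 1)
  refine ⟨b - a, ?_, ?_⟩
  · have : (ψ M : ℝ) + 1 ≤ ψ (M + 1) := by exact_mod_cast hψ (Nat.lt_succ_self M)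
    have : |N| + 1 ≤ b - a := by
      rw [← sub_mul]
      exact le_mul_of_one_le_left (by positivity) (by linarith)
    linarith [le_abs_self N]
  · have := dist_translate_add (f := f) a (b - a) 0
    rw [add_sub_cancel, add_zero] at this
    have h0 : translate 0 f = f := by
      ext q; change f (0 + q) = f q; rw [zero_add]
    rw [h0] at this
    rw [← this]
    exact hd

end AlmostPeriodic

section Parts

variable {J : AddSubmonoid ℝ} {X : Type*} [NormedAddCommGroup X] [NormedSpace ℂ X]
  {P : BUC J (StrongDual ℂ X) →L[ℂ] BUC J (StrongDual ℂ X)}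

theorem restrictTo_mem_BUC {F : Type*} [NormedAddCommGroup F] [NormedSpace ℂ F] {f : ℝ →ᵇ F}
    (hf : UniformContinuous f) : restrictTo J f ∈ BUC J F :=
  hf.comp uniformContinuous_subtype_val

theorem AP.restrictTo_mem_aPart (hJ : J = AddSubmonoid.nonneg ℝ ∨ J = ⊤)
    (hP : IsMinimalIdempotent (compactification (embed J X) translation) P)
    {f : ℝ →ᵇ StrongDual ℂ X} (hf : f ∈ AP (StrongDual ℂ X)) :
    (⟨restrictTo J f, restrictTo_mem_BUC (AP.uniformContinuous hf)⟩ :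
      BUC J (StrongDual ℂ X)) ∈ aPart P := by
  set y : BUC J (StrongDual ℂ X) := ⟨restrictTo J f, restrictTo_mem_BUC (AP.uniformContinuous hf)⟩
    with hy
  obtain ⟨u, hu⟩ := mem_compactification_iff.1 hP.1
  have hval : ∀ (s r : J), (translation s y).1 r = translate (s : ℝ) f r := fun s r => rfl
  obtain ⟨h, -, hh⟩ := IsCompact.ultrafilter_le_nhds (s := closure _) hf
    (u.map fun s : J => translate (s : ℝ) f) (le_principal_iff.2
      (mem_map.2 (Eventually.of_forall fun s => subset_closure ⟨_, rfl⟩)))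
  have hh : Tendsto (fun s : J => translate (s : ℝ) f) u (𝓝 h) := hh
  have hPy : ∀ r : J, (P y).1 r = h r := by
    intro r
    ext x
    have h1 := tendsto_pointwise_iff.1 (tendsto_pointwise_of_tendsto_toW hJ
      (fun s => translation_mem_envelope s (mem_envelope_self y)) (hu y)) r x
    have h2 : Tendsto (fun s : J => translate (s : ℝ) f r) u (𝓝 (h r)) :=
      ((BoundedContinuousFunction.evalCLM ℂ (r : ℝ)).continuous.tendsto h).comp hh
    exact tendsto_nhds_unique h1
      (((ContinuousLinearMap.apply ℂ ℂ x).continuous.tendsto (h r)).comp h2)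
  rw [mem_aPart_iff hP.2.1]
  refine eq_of_forall_dist_le fun ε hε => ?_
  obtain ⟨s₀, hs₀⟩ := (Metric.tendsto_nhds.1 hh (ε / 4) (by positivity)).exists
  obtain ⟨t, hts, htf⟩ := AP.exists_almost_period hf s₀ (show 0 < ε / 4 by positivity)
  let r : J := ⟨t - s₀, mem_of_nonneg hJ (sub_nonneg.2 hts)⟩
  have h1 : ‖translation s₀ y - P y‖ ≤ ε / 4 := norm_le_of_forall (by positivity) fun q => by
    change ‖translate (s₀ : ℝ) f q - (P y).1 q‖ ≤ _
    rw [hPy, ← dist_eq_norm]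
    exact (BoundedContinuousFunction.dist_coe_le_dist _).trans hs₀.le
  have h2 : ‖translation r (translation s₀ y) - y‖ ≤ ε / 4 :=
    norm_le_of_forall (by positivity) fun q => by
      have := (BoundedContinuousFunction.dist_coe_le_dist (f := translate t f) (g := f)
        (q : ℝ)).trans htf.le
      change dist (f (t + q)) (f q) ≤ _ at this
      change ‖f (s₀ + (t - s₀ + q)) - f q‖ ≤ _
      rwa [← dist_eq_norm, show (s₀ : ℝ) + (t - s₀ + q) = t + q by ring]
  have h3 : ‖translation r (P y) - y‖ ≤ ε / 2 := by
    have h4 := norm_translation_le r (translation s₀ y - P y)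
    rw [map_sub] at h4
    calc ‖translation r (P y) - y‖ = ‖(translation r (translation s₀ y) - y) -
          (translation r (translation s₀ y) - translation r (P y))‖ := by congr 1; abel
      _ ≤ ε / 2 := (norm_sub_le _ _).trans (by linarith)
  have hPP : P (P y) = P y := (mem_aPart_iff hP.2.1).1 ⟨y, rfl⟩
  have h5 : ‖translation r (P y) - P y‖ ≤ ε / 2 := by
    have := hu.norm_apply_le hJ (translation r (P y) - y)
    rw [map_sub, hu.apply_translation hJ, hPP] at this
    exact this.trans h3
  rw [dist_eq_norm]
  calc ‖P y - y‖ = ‖(translation r (P y) - y) - (translation r (P y) - P y)‖ := by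
        congr 1; abel
    _ ≤ ε := (norm_sub_le _ _).trans (by linarith)

theorem translation_mem_compactification (t : J) :
    translation t ∈ compactification (embed J X) translation :=
  subset_closure ⟨t, rfl⟩

/-- If elements of the two-sided orbit of `y` tend weakly to `0` then `P y = 0`. -/
theorem mem_zeroPart_of_weakly_null (hJ : J = AddSubmonoid.nonneg ℝ ∨ J = ⊤)
    (hP : IsMinimalIdempotent (compactification (embed J X) translation) P)
    {y : BUC J (StrongDual ℂ X)} {z : ℕ → BUC J (StrongDual ℂ X)}
    (hz : ∀ n, ∃ s, z n = translation s y ∨ translation s (z n) = y)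
    (h : ∀ φ : StrongDual ℂ (BUC J (StrongDual ℂ X)), Tendsto (fun n => φ (z n)) atTop (𝓝 0)) :
    y ∈ zeroPart P := by
  rw [mem_zeroPart_iff hP.2.1]
  obtain ⟨u, hu⟩ := mem_compactification_iff.1 hP.1
  refine eq_zero_of_isReversible hJ (isReversible_of_mem_aPart hJ hP ⟨y, rfl⟩) ?_
  have hlim : Tendsto (fun n => toW (embed J X) (P (z n))) atTop (𝓝 0) :=
    tendsto_weakDual_iff.2 fun g =>
      h ((ContinuousLinearMap.apply ℂ ℂ g).comp ((embed J X).comp P))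
  refine isClosed_closure.mem_of_tendsto hlim (Eventually.of_forall fun n => ?_)
  obtain ⟨s, hs | hs⟩ := hz n
  · refine subset_closure ⟨P (z n), ⟨s, ?_⟩, rfl⟩
    rw [hs, hu.apply_translation hJ]
  · obtain ⟨V, hV, hVP⟩ := hP.left_minimal hJ (translation_mem_compactification s)
    obtain ⟨v, hv⟩ := mem_compactification_iff.1 hV
    have hVz : V (P y) = P (z n) := by
      have : V (translation s (P (z n))) = P (z n) := DFunLike.congr_fun hVP (z n)
      rwa [← hu.apply_translation hJ, hs] at this
    rw [← hVz]
    exact mem_closure_of_tendsto (hv (P y)) (Eventually.of_forall fun t => ⟨_, ⟨t, rfl⟩, rfl⟩)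

end Parts

section WeakTopology

variable {E : Type*} [NormedAddCommGroup E] [NormedSpace ℂ E]

theorem tendsto_dual_of_tendsto_weak {α : Type*} {l : Filter α} {f : α → E} {w : E}
    (h : Tendsto (fun a => toWeakSpace ℂ E (f a)) l (𝓝 (toWeakSpace ℂ E w)))
    (φ : StrongDual ℂ E) : Tendsto (fun a => φ (f a)) l (𝓝 (φ w)) :=
  ((WeakBilin.eval_continuous (topDualPairing ℂ E).flip φ).tendsto _).comp h

theorem isClosed_toWeakSpace_image {C : Set E} (hC : Convex ℝ C) (hcl : IsClosed C) :
    IsClosed (toWeakSpace ℂ E '' C) := by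
  rw [← closure_eq_iff_isClosed, ← hC.toWeakSpace_closure ℂ, hcl.closure_eq]

theorem isClosed_preimage_of_weakly_continuous {α : Type*} [TopologicalSpace α] {f : α → E}
    (hf : Continuous fun a => toWeakSpace ℂ E (f a)) {C : Set E} (hC : Convex ℝ C)
    (hcl : IsClosed C) : IsClosed (f ⁻¹' C) := by
  convert (isClosed_toWeakSpace_image hC hcl).preimage hf using 1
  ext a
  exact ((toWeakSpace ℂ E).injective.mem_set_image (s := C)).symm

/-- A weakly continuous map on a separable Baire space has arbitrarily small norm oscillation on
suitable nonempty open sets. -/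
theorem exists_isOpen_norm_sub_le_of_weakly_continuous {α : Type*} [TopologicalSpace α]
    [TopologicalSpace.SeparableSpace α] [BaireSpace α] [Nonempty α] {f : α → E}
    (hf : Continuous fun a => toWeakSpace ℂ E (f a)) {ε : ℝ} (hε : 0 < ε) :
    ∃ O : Set α, IsOpen O ∧ O.Nonempty ∧ ∀ a ∈ O, ∀ b ∈ O, ‖f a - f b‖ ≤ ε := by
  obtain ⟨D, hD, hDd⟩ := TopologicalSpace.exists_countable_dense α
  set M : Submodule ℝ E := (Submodule.span ℝ (f '' D)).topologicalClosure with hM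
  have hsep : TopologicalSpace.IsSeparable (M : Set E) := by
    rw [hM, Submodule.topologicalClosure_coe]
    exact ((hD.image f).isSeparable.span (R := ℝ)).closure
  have hmem : ∀ a, f a ∈ M := by
    have hcl : IsClosed (f ⁻¹' (M : Set E)) := isClosed_preimage_of_weakly_continuous hf
      M.convex (Submodule.isClosed_topologicalClosure _)
    intro a
    have hsub : closure D ⊆ f ⁻¹' (M : Set E) := hcl.closure_subset_iff.2 fun d hd =>
      Submodule.le_topologicalClosure _ (Submodule.subset_span ⟨d, hd, rfl⟩)
    exact hsub (hDd a)
  obtain ⟨c, hc, hcM⟩ := hsep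
  have : Countable c := hc.to_subtype
  obtain ⟨k, hk⟩ := nonempty_interior_of_iUnion_of_closed
    (f := fun k : c => f ⁻¹' Metric.closedBall (k : E) (ε / 2))
    (fun k => isClosed_preimage_of_weakly_continuous hf (convex_closedBall _ _)
      Metric.isClosed_closedBall) (by
      refine Set.eq_univ_of_forall fun a => ?_
      obtain ⟨k, hk, hak⟩ := Metric.mem_closure_iff.1 (hcM (hmem a)) (ε / 2) (half_pos hε)
      exact Set.mem_iUnion.2 ⟨⟨k, hk⟩, hak.le⟩)
  refine ⟨_, isOpen_interior, hk, fun a ha b hb => ?_⟩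
  have h1 := Metric.mem_closedBall.1 (Set.mem_preimage.1 (interior_subset ha))
  have h2 := Metric.mem_closedBall.1 (Set.mem_preimage.1 (interior_subset hb))
  rw [← dist_eq_norm]
  linarith [dist_triangle_right (f a) (f b) k]

end WeakTopology

section WeaklyAlmostPeriodic

variable {S F : Type*} [AddCommMonoid S] [TopologicalSpace S] [ContinuousAdd S]
  [NormedAddCommGroup F] [NormedSpace ℂ F] {f : S →ᵇ F}

theorem W.weakly_continuous (hf : f ∈ W S F) :
    Continuous fun t => toWeakSpace ℂ (S →ᵇ F) (translate t f) := by
  refine continuous_iff_ultrafilter.2 fun t u hu => ?_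
  obtain ⟨k, -, hk⟩ := IsCompact.ultrafilter_le_nhds (s := closure _) hf
    (u.map fun t => toWeakSpace ℂ (S →ᵇ F) (translate t f)) (le_principal_iff.2
      (mem_map.2 (Eventually.of_forall fun s => subset_closure ⟨_, ⟨s, rfl⟩, rfl⟩)))
  obtain ⟨k, rfl⟩ := (toWeakSpace ℂ (S →ᵇ F)).surjective k
  suffices k = translate t f from this ▸ hk
  ext s
  refine (SeparatingDual.eq_iff_forall_dual_eq (R := ℂ)).2 fun ψ => ?_
  refine tendsto_nhds_unique (tendsto_dual_of_tendsto_weak hk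
    (ψ.comp (BoundedContinuousFunction.evalCLM ℂ s))) ?_
  have hc : Continuous fun r : S => ψ (f (r + s)) :=
    ψ.continuous.comp (f.continuous.comp (continuous_id.add continuous_const))
  exact (hc.tendsto t).mono_left hu

theorem W.exists_isOpen [TopologicalSpace.SeparableSpace S] [BaireSpace S] (hf : f ∈ W S F)
    {ε : ℝ} (hε : 0 < ε) :
    ∃ O : Set S, IsOpen O ∧ O.Nonempty ∧ ∀ a ∈ O, ∀ b ∈ O, ∀ t, dist (f (a + t)) (f (b + t)) ≤ ε := by
  obtain ⟨O, hO, hne, h⟩ :=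
    exists_isOpen_norm_sub_le_of_weakly_continuous (W.weakly_continuous hf) hε
  refine ⟨O, hO, hne, fun a ha b hb t => ?_⟩
  refine (BoundedContinuousFunction.dist_coe_le_dist (f := translate a f) (g := translate b f)
    t).trans ?_
  rw [dist_eq_norm]
  exact h a ha b hb

theorem W.uniformContinuous_real {f : ℝ →ᵇ F} (hf : f ∈ W ℝ F) : UniformContinuous f := by
  refine Metric.uniformContinuous_iff.2 fun ε hε => ?_
  obtain ⟨O, hO, ⟨a, ha⟩, h⟩ := W.exists_isOpen hf (half_pos hε)
  obtain ⟨δ, hδ, hball⟩ := Metric.isOpen_iff.1 hO a ha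
  refine ⟨δ, hδ, fun {r q} hrq => ?_⟩
  have hb : a + (q - r) ∈ O := hball (by
    rw [Metric.mem_ball, Real.dist_eq]
    rw [dist_comm, Real.dist_eq] at hrq
    simpa using hrq)
  have := h a ha _ hb (r - a)
  rw [show a + (r - a) = r by ring, show a + (q - r) + (r - a) = q by ring] at this
  linarith

theorem W.uniformContinuous {J : AddSubmonoid ℝ} (hJ : J = AddSubmonoid.nonneg ℝ ∨ J = ⊤)
    {f : J →ᵇ F} (hf : f ∈ W J F) : UniformContinuous f := by
  have hcl : Topology.IsClosedEmbedding (Subtype.val : J → ℝ) :=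
    (isClosed_coe hJ).isClosedEmbedding_subtypeVal
  have : CompleteSpace J := (isClosed_coe hJ).completeSpace_coe
  have key : ∀ ε > 0, ∃ δ > 0, ∀ r q : J, (r : ℝ) ≤ q → (q : ℝ) - r < δ → dist (f r) (f q) < ε := by
    intro ε hε
    obtain ⟨O, hO, ⟨a, ha⟩, h⟩ := W.exists_isOpen hf (half_pos hε)
    obtain ⟨δ, hδ, hball⟩ := Metric.isOpen_iff.1 hO a ha
    have hK : IsCompact (Subtype.val ⁻¹' Set.Icc (0 : ℝ) (a + 1) : Set J) :=
      hcl.isCompact_preimage isCompact_Icc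
    obtain ⟨δ', hδ', h'⟩ := Metric.uniformContinuousOn_iff.1
      (hK.uniformContinuousOn_of_continuous f.continuous.continuousOn) ε hε
    refine ⟨min δ (min δ' 1), by positivity, fun r q hrq hlt => ?_⟩
    have hlt1 : (q : ℝ) - r < δ := hlt.trans_le (min_le_left _ _)
    have hlt2 : (q : ℝ) - r < δ' := hlt.trans_le ((min_le_right _ _).trans (min_le_left _ _))
    have hlt3 : (q : ℝ) - r < 1 := hlt.trans_le ((min_le_right _ _).trans (min_le_right _ _))
    by_cases hra : (r : ℝ) - a ∈ J
    · let d : J := ⟨q - r, mem_of_nonneg hJ (sub_nonneg.2 hrq)⟩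
      have hb : a + d ∈ O := hball (by
        rw [Metric.mem_ball, Subtype.dist_eq, Real.dist_eq]
        change |(a : ℝ) + (q - r) - a| < δ
        rwa [add_sub_cancel_left, abs_of_nonneg (sub_nonneg.2 hrq)])
      have := h a ha _ hb ⟨r - a, hra⟩
      have e1 : a + ⟨r - a, hra⟩ = r := Subtype.ext (by
        change (a : ℝ) + (r - a) = r; ring)
      have e2 : a + d + ⟨r - a, hra⟩ = q := Subtype.ext (by
        change (a : ℝ) + (q - r) + (r - a) = q; ring)
      rw [e1, e2] at this
      linarith
    · have hr : (r : ℝ) < a := by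
        by_contra hra'
        exact hra (mem_of_nonneg hJ (sub_nonneg.2 (not_lt.1 hra')))
      have hr0 : 0 ≤ (r : ℝ) := by
        rcases hJ with rfl | rfl
        · exact r.2
        · exact absurd trivial hra
      refine h' r ⟨hr0, by linarith⟩ q ⟨hr0.trans hrq, by linarith⟩ ?_
      rw [dist_comm, Subtype.dist_eq, Real.dist_eq, abs_of_nonneg (sub_nonneg.2 hrq)]
      exact hlt2
  refine Metric.uniformContinuous_iff.2 fun ε hε => ?_
  obtain ⟨δ, hδ, h⟩ := key ε hε
  refine ⟨δ, hδ, fun {r q} hrq => ?_⟩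
  rw [Subtype.dist_eq, Real.dist_eq] at hrq
  rcases le_total (r : ℝ) q with hle | hle
  · exact h r q hle (by rw [abs_sub_comm] at hrq; exact (le_abs_self _).trans_lt hrq)
  · rw [dist_comm]
    exact h q r hle ((le_abs_self _).trans_lt hrq)

end WeaklyAlmostPeriodic

section Parts

variable {J : AddSubmonoid ℝ} {X : Type*} [NormedAddCommGroup X] [NormedSpace ℂ X]
  {P : BUC J (StrongDual ℂ X) →L[ℂ] BUC J (StrongDual ℂ X)}

theorem W₀.mem_zeroPart (hJ : J = AddSubmonoid.nonneg ℝ ∨ J = ⊤)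
    (hP : IsMinimalIdempotent (compactification (embed J X) translation) P)
    {f : J →ᵇ StrongDual ℂ X} (hf : f ∈ W₀ J (StrongDual ℂ X)) :
    (⟨f, W.uniformContinuous hJ hf.1⟩ : BUC J (StrongDual ℂ X)) ∈ zeroPart P := by
  obtain ⟨t, ht⟩ := hf.2
  refine mem_zeroPart_of_weakly_null hJ hP
    (z := fun n => translation (t n) ⟨f, W.uniformContinuous hJ hf.1⟩)
    (fun n => ⟨t n, Or.inl rfl⟩) fun φ => ?_
  obtain ⟨ψ, hψ, -⟩ := exists_extension_norm_eq (BUC J (StrongDual ℂ X)) φ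
  rw [← map_zero (toWeakSpace ℂ _)] at ht
  have := tendsto_dual_of_tendsto_weak ht ψ
  rw [map_zero] at this
  exact this.congr fun n => hψ (translation (t n) ⟨f, W.uniformContinuous hJ hf.1⟩)

/-- Restriction to `J` as a continuous linear map. -/
noncomputable def restrictToCLM (J : AddSubmonoid ℝ) (F : Type*) [NormedAddCommGroup F]
    [NormedSpace ℂ F] : (ℝ →ᵇ F) →L[ℂ] (J →ᵇ F) :=
  LinearMap.mkContinuous
    { toFun := restrictTo J
      map_add' := fun _ _ => rfl
      map_smul' := fun _ _ => rfl } 1 fun f => by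
        rw [one_mul]
        exact (BoundedContinuousFunction.norm_le (norm_nonneg _)).2 fun s =>
          f.norm_coe_le_norm (s : ℝ)

theorem uniformContinuous_translate {F : Type*} [NormedAddCommGroup F] {f : ℝ →ᵇ F}
    (hf : UniformContinuous f) (t : ℝ) : UniformContinuous (translate t f) :=
  hf.comp (uniformContinuous_const.add uniformContinuous_id)

theorem W₀.restrictTo_mem_zeroPart (hJ : J = AddSubmonoid.nonneg ℝ ∨ J = ⊤)
    (hP : IsMinimalIdempotent (compactification (embed J X) translation) P)
    {f : ℝ →ᵇ StrongDual ℂ X} (hf : f ∈ W₀ ℝ (StrongDual ℂ X)) :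
    (⟨restrictTo J f, restrictTo_mem_BUC (W.uniformContinuous_real hf.1)⟩ :
      BUC J (StrongDual ℂ X)) ∈ zeroPart P := by
  obtain ⟨t, ht⟩ := hf.2
  have huc := W.uniformContinuous_real hf.1
  refine mem_zeroPart_of_weakly_null hJ hP (z := fun n =>
    ⟨restrictTo J (translate (t n) f), restrictTo_mem_BUC (uniformContinuous_translate huc (t n))⟩)
    (fun n => ?_) fun φ => ?_
  · rcases le_total 0 (t n) with h | h
    · exact ⟨⟨t n, mem_of_nonneg hJ h⟩, Or.inl rfl⟩
    · refine ⟨⟨-t n, mem_of_nonneg hJ (neg_nonneg.2 h)⟩, Or.inr ?_⟩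
      refine Subtype.ext (BoundedContinuousFunction.ext fun s => ?_)
      change f (t n + (-t n + s)) = f s
      rw [add_neg_cancel_left]
  · obtain ⟨ψ, hψ, -⟩ := exists_extension_norm_eq (BUC J (StrongDual ℂ X)) φ
    rw [← map_zero (toWeakSpace ℂ _)] at ht
    have := tendsto_dual_of_tendsto_weak ht (ψ.comp (restrictToCLM J (StrongDual ℂ X)))
    rw [map_zero] at this
    exact this.congr fun n => hψ ⟨restrictTo J (translate (t n) f),
      restrictTo_mem_BUC (uniformContinuous_translate huc (t n))⟩

/-- Constant functions in `BUC`. -/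
noncomputable def constBUC (J : AddSubmonoid ℝ) {F : Type*} [NormedAddCommGroup F]
    [NormedSpace ℂ F] (v : F) : BUC J F :=
  ⟨BoundedContinuousFunction.const J v, uniformContinuous_const⟩

theorem aPart_ne_bot (hJ : J = AddSubmonoid.nonneg ℝ ∨ J = ⊤) [Nontrivial X]
    (hP : IsMinimalIdempotent (compactification (embed J X) translation) P) : aPart P ≠ ⊥ := by
  obtain ⟨v, hv⟩ := exists_ne (0 : StrongDual ℂ X)
  obtain ⟨u, hu⟩ := mem_compactification_iff.1 hP.1
  have hmem : constBUC J v ∈ aPart P := by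
    refine (mem_aPart_iff hP.2.1).2 (injective_toW hJ ?_)
    exact tendsto_nhds_unique (hu (constBUC J v)) tendsto_const_nhds
  intro hbot
  rw [hbot, Submodule.mem_bot] at hmem
  exact hv (DFunLike.congr_fun (congrArg Subtype.val hmem) (0 : J))

theorem lipschitzWith_tent : LipschitzWith 1 fun s : ℝ => max 0 (1 - |s|) := by
  refine LipschitzWith.const_max (LipschitzWith.of_dist_le_mul fun a b => ?_) 0
  rw [NNReal.coe_one, one_mul, Real.dist_eq, Real.dist_eq, sub_sub_sub_cancel_left, abs_sub_comm]
  exact abs_abs_sub_abs_le_abs_sub a b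

/-- The tent function supported on `[-1, 1]` with peak `v`. -/
noncomputable def tentBUC (J : AddSubmonoid ℝ) {F : Type*} [NormedAddCommGroup F]
    [NormedSpace ℂ F] (v : F) : BUC J F :=
  have huc : UniformContinuous fun s : J => ((max 0 (1 - |(s : ℝ)|) : ℝ) : ℂ) • v :=
    ((ContinuousLinearMap.toSpanSingleton ℂ v).uniformContinuous.comp
      Complex.isometry_ofReal.uniformContinuous).comp
        (lipschitzWith_tent.uniformContinuous.comp uniformContinuous_subtype_val)
  ⟨BoundedContinuousFunction.ofNormedAddCommGroup _ huc.continuous ‖v‖ fun s => by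
    rw [norm_smul, Complex.norm_real, Real.norm_of_nonneg (le_max_left _ _)]
    exact mul_le_of_le_one_left (norm_nonneg v)
      (max_le zero_le_one (sub_le_self _ (abs_nonneg _))), huc⟩

theorem sum_tent_le_one (N : ℕ) (s : ℝ) :
    ∑ n ∈ Finset.range N, max 0 (1 - |3 * (n : ℝ) + s|) ≤ 1 := by
  by_cases h : ∃ m ∈ Finset.range N, |3 * (m : ℝ) + s| < 1
  · obtain ⟨m, hm, hms⟩ := h
    rw [Finset.sum_eq_single_of_mem m hm]
    · exact max_le zero_le_one (sub_le_self _ (abs_nonneg _))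
    · intro n _ hnm
      refine max_eq_left (sub_nonpos.2 ?_)
      by_contra! hlt
      rw [abs_lt] at hlt hms
      refine hnm (le_antisymm ?_ ?_) <;> refine Nat.lt_succ_iff.1 ?_
      · have : (n : ℝ) < m + 1 := by linarith
        exact_mod_cast this
      · have : (m : ℝ) < n + 1 := by linarith
        exact_mod_cast this
  · push Not at h
    rw [Finset.sum_eq_zero fun n hn => max_eq_left (sub_nonpos.2 (h n hn))]
    exact zero_le_one

/-- Translates of a tent function tend weakly to `0`. -/
theorem tendsto_translation_tent (t : ℕ → J) (ht : ∀ n, (t n : ℝ) = 3 * n) {F : Type*}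
    [NormedAddCommGroup F] [NormedSpace ℂ F] (v : F) (φ : StrongDual ℂ (BUC J F)) :
    Tendsto (fun n => φ (translation (t n) (tentBUC J v))) atTop (𝓝 0) := by
  choose c hc hcφ using fun n => RCLike.exists_norm_eq_mul_self (φ (translation (t n) (tentBUC J v)))
  have hbound : ∀ N, ∑ n ∈ Finset.range N, ‖φ (translation (t n) (tentBUC J v))‖ ≤
      ‖φ‖ * ‖v‖ := by
    intro N
    have hsum : ‖∑ n ∈ Finset.range N, c n • translation (t n) (tentBUC J v)‖ ≤ ‖v‖ := by
      refine norm_le_of_forall (norm_nonneg v) fun s => ?_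
      have hval : (∑ n ∈ Finset.range N, c n • translation (t n) (tentBUC J v)).1 s =
          ∑ n ∈ Finset.range N, c n • ((max 0 (1 - |3 * (n : ℝ) + s|) : ℝ) : ℂ) • v := by
        rw [AddSubmonoidClass.coe_finsetSum, BoundedContinuousFunction.sum_apply]
        refine Finset.sum_congr rfl fun n _ => ?_
        rw [← ht n]
        rfl
      rw [hval]
      calc _ ≤ ∑ n ∈ Finset.range N, max 0 (1 - |3 * (n : ℝ) + s|) * ‖v‖ := by
            refine norm_sum_le_of_le _ fun n _ => ?_
            rw [norm_smul, hc, one_mul, norm_smul, Complex.norm_real,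
              Real.norm_of_nonneg (le_max_left _ _)]
        _ = (∑ n ∈ Finset.range N, max 0 (1 - |3 * (n : ℝ) + s|)) * ‖v‖ := by
            rw [Finset.sum_mul]
        _ ≤ ‖v‖ := mul_le_of_le_one_left (norm_nonneg v) (sum_tent_le_one N s)
    have heq : ((∑ n ∈ Finset.range N, ‖φ (translation (t n) (tentBUC J v))‖ : ℝ) : ℂ) =
        φ (∑ n ∈ Finset.range N, c n • translation (t n) (tentBUC J v)) := by
      rw [map_sum, Complex.ofReal_sum]
      refine Finset.sum_congr rfl fun n _ => ?_
      rw [map_smul, smul_eq_mul]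
      exact hcφ n
    calc _ = ‖((∑ n ∈ Finset.range N, ‖φ (translation (t n) (tentBUC J v))‖ : ℝ) : ℂ)‖ := by
          rw [Complex.norm_real, Real.norm_of_nonneg (Finset.sum_nonneg fun _ _ => norm_nonneg _)]
      _ ≤ ‖φ‖ * ‖v‖ := by
          rw [heq]
          exact φ.le_opNorm_of_le hsum
  exact tendsto_zero_iff_norm_tendsto_zero.2
    (summable_of_sum_range_le (fun _ => norm_nonneg _) hbound).tendsto_atTop_zero

theorem zeroPart_ne_bot (hJ : J = AddSubmonoid.nonneg ℝ ∨ J = ⊤) [Nontrivial X]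
    (hP : IsMinimalIdempotent (compactification (embed J X) translation) P) : zeroPart P ≠ ⊥ := by
  obtain ⟨v, hv⟩ := exists_ne (0 : StrongDual ℂ X)
  let t : ℕ → J := fun n => ⟨3 * n, mem_of_nonneg hJ (by positivity)⟩
  have hmem : tentBUC J v ∈ zeroPart P :=
    mem_zeroPart_of_weakly_null hJ hP (z := fun n => translation (t n) (tentBUC J v))
      (fun n => ⟨t n, Or.inl rfl⟩) (tendsto_translation_tent t (fun _ => rfl) v)
  intro hbot
  rw [hbot, Submodule.mem_bot] at hmem
  have h0 : ((max 0 (1 - |((0 : J) : ℝ)|) : ℝ) : ℂ) • v = 0 :=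
    DFunLike.congr_fun (congrArg Subtype.val hmem) (0 : J)
  rw [AddSubmonoid.coe_zero, abs_zero, sub_zero, max_eq_right zero_le_one, Complex.ofReal_one,
    one_smul] at h0
  exact hv h0

end Parts

end DualRep

open DualRep in
theorem lemma7p13 {X : Type*} [NormedAddCommGroup X] [NormedSpace ℂ X] [CompleteSpace X]
    (J : AddSubmonoid ℝ) (hJ : J = AddSubmonoid.nonneg ℝ ∨ J = ⊤) :
    -- the closed absolutely convex hull of the translates of `f`, formed in `BUC(J, X*)`, is
    -- compact, and it agrees with the hull formed in the larger space `L¹(J, X)*`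
    (∀ f : BUC J (StrongDual ℂ X),
      @IsCompact _ (sigma (embed J X))
        (@closure _ (sigma (embed J X)) (absConvexHull ℂ (orbit translation f))) ∧
      toW (embed J X) ''
        (@closure _ (sigma (embed J X)) (absConvexHull ℂ (orbit translation f))) =
          acHull (embed J X) translation f) ∧
    -- the translations form a dual semigroup representation
    IsDualRepresentation (embed J X) (translation : J → _) ∧
    -- there are minimal idempotents `P`, and each of them gives a splitting
    (∃ P, IsMinimalIdempotent (compactification (embed J X) translation) P) ∧
    (∀ P, IsMinimalIdempotent (compactification (embed J X) translation) P →
      IsCompl (aPart P) (zeroPart P) ∧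
      (∀ y ∈ aPart P, IsReversible (embed J X) translation y) ∧
      (∀ y ∈ zeroPart P, IsFlight (embed J X) translation y) ∧
      -- almost periodic functions lie in the first summand, `W₀` in the second
      restrictTo J '' AP (StrongDual ℂ X) ⊆ (aPart P).map (BUC J (StrongDual ℂ X)).subtype ∧
      W₀ J (StrongDual ℂ X) ⊆ (zeroPart P).map (BUC J (StrongDual ℂ X)).subtype ∧
      restrictTo J '' W₀ ℝ (StrongDual ℂ X) ⊆ (zeroPart P).map (BUC J (StrongDual ℂ X)).subtype ∧
      -- the splitting is nontrivial
      (Nontrivial X → aPart P ≠ ⊥ ∧ zeroPart P ≠ ⊥)) := by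
  refine ⟨fun f => ⟨isCompact_closure_absConvexHull f, toW_image_closure_absConvexHull _ _ _
    ((acHull_subset_image_envelope f).trans (Set.image_subset_range _ _))⟩,
    isDualRepresentation hJ, exists_isMinimalIdempotent hJ, fun P hP => ?_⟩
  refine ⟨isCompl_parts hP.2.1, fun y hy => isReversible_of_mem_aPart hJ hP hy,
    fun y hy => isFlight_of_mem_zeroPart hP hy, ?_, ?_, ?_,
    fun _ => ⟨aPart_ne_bot hJ hP, zeroPart_ne_bot hJ hP⟩⟩
  · rintro _ ⟨f, hf, rfl⟩
    exact ⟨_, AP.restrictTo_mem_aPart hJ hP hf, rfl⟩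
  · intro f hf
    exact ⟨_, W₀.mem_zeroPart hJ hP hf, rfl⟩
  · rintro _ ⟨f, hf, rfl⟩
    exact ⟨_, W₀.restrictTo_mem_zeroPart hJ hP hf, rfl⟩
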